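/- Let $k$ be a commutative ring with identity and let $\mathcal C=\mathcal C_1\times\cdots\times\mathcal C_m$, where each $\mathcal C_i$ is a category with object set $\mathbb N$ such that: (a) $\mathcal C_i(r,n)\neq\emptyset$ if and only if $r\le n$; (b) if $r<l<n$, every morphism $r\to n$ factors as a composite $r\to l\to n$; (c) every endomorphism is an isomorphism; (d) if $r<n$, the group $\mathcal C_i(n,n)$ acts transitively on $\mathcal C_i(r,n)$; (e) there are a faithful functor $\psi_i:\mathcal C_i\to\mathcal C_i$ with $\psi_i(n)=n+1$ for all $n$ and a natural transformation $\varepsilon_i:\mathrm{Id}\to\psi_i$ such that, for every $n$, the natural homomorphism $M_i(n)\to M_i(n)\circ\psi_i$ induced by $\varepsilon_i$, where $M_i(n)=k\mathcal C_i(n,-)$, is injective and its cokernel is a projective $\mathcal C_i$-module of generation degree at most $n-1$. Here a $\mathcal D$-module is a functor from $\mathcal D$ to the category of $k$-modules. The generation degree of a $\mathcal C_i$-module $V$ is the supremum of all $n$ with $V_n\neq\sum_{r<n,\,f\in\mathcal C_i(r,n)}V(f)(V_r)$, or $-1$ if there is no such $n$. For $\mathbf n=(n_1,\dots,n_m)$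 write $|\mathbf n|=n_1+\cdots+n_m$ and $M(\mathbf n)=k\mathcal C(\mathbf n,-)$. A $\mathcal C$-module $V$ is \emph{generated in finite degrees} if there are a number $N$ and a surjection $\bigoplus_{j\in I}M(\mathbf n_j)\to V$ with $|\mathbf n_j|<N$ for all $j\in I$; it is \emph{presented in finite degrees} if there is a surjection $\bigoplus_{j\in I}M(\mathbf n_j)\to V$ such that both $V$ and the kernel are generated in finite degrees. Then the full subcategory of the category of $\mathcal C$-modules consisting of the modules presented in finite degrees is abelian. Moreover, for every homomorphism $\alpha:U\to V$ between $\mathcal C$-modules presented in finite degrees, the kernel, cokernel and image of $\alpha$ (formed in the category of all $\mathcal C$-modules) are presented in finite degrees. -/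

import Mathlib

open CategoryTheory CategoryTheory.Limits

universe u

namespace FinDeg

/-- The axioms on a category `C` whose object set is identified with `ℕ` through `deg`:
nonemptiness of morphism sets is governed by `≤`, every morphism factors through every
intermediate object, endomorphisms are invertible, and `C(n, n)` acts transitively on `C(r, n)`
for `r < n`. -/
structure IsTransitiveTypeA {C : Type u} [SmallCategory C] (deg : C ≃ ℕ) : Prop where
  nonempty_hom_iff : ∀ r n : C, Nonempty (r ⟶ n) ↔ deg r ≤ deg n
  exists_factor : ∀ r l n : C, deg r < deg l → deg l < deg n → ∀ f : r ⟶ n,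
    ∃ (g : r ⟶ l) (h : l ⟶ n), f = g ≫ h
  isIso_of_endo : ∀ (n : C) (f : n ⟶ n), IsIso f
  transitive : ∀ r n : C, deg r < deg n → ∀ f g : r ⟶ n, ∃ σ : n ⟶ n, f ≫ σ = g

section Modules

variable (k : Type u) [CommRing k] {C : Type u} [SmallCategory C]

/-- The free module `M(n) = k C(n, -)` on the functor represented by `n`. -/
noncomputable def freeModule (n : C) : C ⥤ ModuleCat.{u} k :=
  coyoneda.obj (Opposite.op n) ⋙ ModuleCat.free k

variable {k}

/-- The submodule `∑ f · V_r` of `V_n`, over all `r` of rank smaller than `n` and all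
`f : r ⟶ n`. -/
def decomposables (rk : C → ℕ) (V : C ⥤ ModuleCat.{u} k) (n : C) : Submodule k (V.obj n) :=
  ⨆ (r : C) (_ : rk r < rk n) (f : r ⟶ n), LinearMap.range (V.map f).hom

/-- The value at `n` of the zeroth homology of `V`. -/
abbrev zerothHomology (rk : C → ℕ) (V : C ⥤ ModuleCat.{u} k) (n : C) : Type u :=
  V.obj n ⧸ decomposables rk V n

/-- The generation degree: the supremum of the ranks of all `n` at which the zeroth homology
does not vanish, and `-1` if there is no such `n`. -/
noncomputable def generationDegree (rk : C → ℕ) (V : C ⥤ ModuleCat.{u} k) : EReal :=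
  sSup (insert (-1) {d : EReal | ∃ n : C, Nontrivial (zerothHomology rk V n) ∧ d = (rk n : EReal)})

/-- `V` admits a surjection from a direct sum of free modules `M(n)` with all the
ranks of the `n` that occur smaller than some `N`. -/
def GeneratedInFiniteDegrees (rk : C → ℕ) (V : C ⥤ ModuleCat.{u} k) : Prop :=
  ∃ (N : ℕ) (I : Type u) (n : I → C) (p : (∐ fun i => freeModule k (n i)) ⟶ V),
    (∀ i, rk (n i) < N) ∧ Epi p

/-- `V` admits a surjection from a direct sum of free modules `M(n)` such that both `V` and the
kernel are generated in finite degrees. -/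
def PresentedInFiniteDegrees (rk : C → ℕ) : ObjectProperty (C ⥤ ModuleCat.{u} k) := fun V =>
  ∃ (I : Type u) (n : I → C) (p : (∐ fun i => freeModule k (n i)) ⟶ V),
    Epi p ∧ GeneratedInFiniteDegrees rk V ∧ GeneratedInFiniteDegrees rk (kernel p)

/-- The natural homomorphism from `V` to its shift `V ∘ ψ`, given at `n` by `v ↦ ε_n · v`. -/
def toShift {ψ : C ⥤ C} (ε : 𝟭 C ⟶ ψ) (V : C ⥤ ModuleCat.{u} k) : V ⟶ ψ ⋙ V where
  app n := V.map (ε.app n)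
  naturality _ _ f := by
    have h := ε.naturality f
    dsimp only [Functor.id_map, Functor.id_obj] at h
    dsimp only [Functor.comp_map, Functor.comp_obj, Functor.id_obj]
    rw [← V.map_comp, ← V.map_comp, h]

variable (k)

/-- The axioms on the self-embedding `ψ` and the natural transformation `ε`: `ψ` is faithful and
raises degrees by one, and for every `n` the natural homomorphism from `M(n)` to its shift is
injective with projective cokernel of generation degree at most `n - 1`. -/
structure IsShift (deg : C ≃ ℕ) (ψ : C ⥤ C) (ε : 𝟭 C ⟶ ψ) : Prop where
  faithful : ψ.Faithful
  deg_obj : ∀ n : C, deg (ψ.obj n) = deg n + 1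
  injective : ∀ n r : C, Function.Injective ((toShift ε (freeModule k n)).app r)
  projective_cokernel : ∀ n : C, Projective (cokernel (toShift ε (freeModule k n)))
  generationDegree_cokernel : ∀ n : C,
    generationDegree deg (cokernel (toShift ε (freeModule k n))) ≤ (deg n : EReal) - 1

end Modules

/-- The rank `|n| = n_1 + ⋯ + n_m` of an object of the product category. -/
def totalRank {m : ℕ} {C : Fin m → Type u} (deg : ∀ i, C i ≃ ℕ) (n : ∀ i, C i) : ℕ :=
  ∑ i, deg i (n i)

end FinDeg

/-! Call a module FP (`FP`) if it is generated in finite degrees and the kernel of every surjection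
onto it from such a module is again generated in finite degrees. A Schanuel argument
(`FP.of_presentation`) shows that one such projective presentation suffices, so FP means presented
in finite degrees. It is stable under extensions, and under quotients by submodules generated in
finite degrees. The theorem thus reduces to coherence (`Coherent`): the kernel of a surjection of FP
modules is FP.

Coherence is proved by induction on the number of factors, passing from `D` to `D × E` where `E`
carries a shift. The tool is the derivative, the cokernel of the map from a module to its shift in
the `E` direction. It is right exact, and is exact on a short exact sequence whose quotient is
torsion free. The axioms on the shift make free modules torsion free, with projective derivative
generated in strictly smaller `E`-degree. Conversely, a module is generated in finite degrees if its
derivative and its lowest layer are (`gfd_of_deriv`).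

Let `V` be the quotient in the given sequence. A second induction, on a bound for the `E`-degrees of
generators of `V`, carries the step (`fp_kernel_of_genBy`). One may replace the middle term by a
free module `P`. Let `K` be the kernel of `P → V`, and `R` the kernel of a free cover of `K`; it
must be shown that `R` is generated in finite degrees. Its lowest layer is controlled by coherence
over `D`. Since `K` is torsion free, its derivative is controlled once the derivative of `K` is FP.
That derivative maps onto the kernel of the derivative of `P → V`, which is FP by the inner
induction. By the snake lemma, the kernel `T` of this map embeds in the part of `V` killed by `ε`.
Hence `T` lives in finitely many layers, each FP over `D`, so `T` is FP (`fp_of_layers`). -/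

namespace FinDeg

/-! ### Pointwise exactness of sequences of modules -/

section Exactness

variable {k : Type u} [CommRing k] {C : Type u} [SmallCategory C]

/-- A pointwise short exact sequence of `C`-modules. -/
structure IsSES {A B D : C ⥤ ModuleCat.{u} k} (f : A ⟶ B) (g : B ⟶ D) : Prop where
  inj : ∀ n, Function.Injective (f.app n)
  exact : ∀ n, Function.Exact (f.app n) (g.app n)
  surj : ∀ n, Function.Surjective (g.app n)

lemma epi_of_surjective {A B : C ⥤ ModuleCat.{u} k} {f : A ⟶ B}
    (h : ∀ n, Function.Surjective (f.app n)) : Epi f := by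
  rw [NatTrans.epi_iff_epi_app]
  exact fun n => (ModuleCat.epi_iff_surjective _).2 (h n)

lemma surjective_of_epi {A B : C ⥤ ModuleCat.{u} k} (f : A ⟶ B) [Epi f] (n : C) :
    Function.Surjective (f.app n) :=
  (ModuleCat.epi_iff_surjective _).1 inferInstance

lemma mono_of_injective {A B : C ⥤ ModuleCat.{u} k} {f : A ⟶ B}
    (h : ∀ n, Function.Injective (f.app n)) : Mono f := by
  rw [NatTrans.mono_iff_mono_app]
  exact fun n => (ModuleCat.mono_iff_injective _).2 (h n)

lemma injective_of_mono {A B : C ⥤ ModuleCat.{u} k} (f : A ⟶ B) [Mono f] (n : C) :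
    Function.Injective (f.app n) :=
  (ModuleCat.mono_iff_injective _).1 inferInstance

lemma naturality_apply {A B : C ⥤ ModuleCat.{u} k} (f : A ⟶ B) {x y : C} (g : x ⟶ y)
    (a : A.obj x) : f.app y (A.map g a) = B.map g (f.app x a) :=
  NatTrans.naturality_apply f g a

lemma comp_app_apply {A B D : C ⥤ ModuleCat.{u} k} (f : A ⟶ B) (g : B ⟶ D) {x : C}
    (a : A.obj x) : (f ≫ g).app x a = g.app x (f.app x a) := rfl

/-- Evaluation at an object is exact, so homology is computed pointwise. -/
lemma exact_iff_app (S : ShortComplex (C ⥤ ModuleCat.{u} k)) :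
    S.Exact ↔ ∀ n, Function.Exact (S.f.app n) (S.g.app n) := by
  have key : ∀ n, (S.map ((evaluation C (ModuleCat.{u} k)).obj n)).Exact ↔
      Function.Exact (S.f.app n) (S.g.app n) := fun n =>
    ShortComplex.ShortExact.moduleCat_exact_iff_function_exact _
  simp only [← key]
  constructor
  · intro h n
    exact h.map _
  · intro h
    rw [ShortComplex.exact_iff_isZero_homology, Functor.isZero_iff]
    intro n
    have := (ShortComplex.exact_iff_isZero_homology _).1 (h n)
    exact this.of_iso (S.mapHomologyIso ((evaluation C (ModuleCat.{u} k)).obj n)).symm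

variable {A B D : C ⥤ ModuleCat.{u} k}

lemma comp_eq_zero_of_exact {f : A ⟶ B} {g : B ⟶ D}
    (h : ∀ n, Function.Exact (f.app n) (g.app n)) : f ≫ g = 0 := by
  ext n a
  exact (h n).apply_apply_eq_zero a

namespace IsSES

variable {f : A ⟶ B} {g : B ⟶ D}

lemma w (h : IsSES f g) : f ≫ g = 0 := comp_eq_zero_of_exact h.exact

lemma shortExact (h : IsSES f g) : (ShortComplex.mk f g h.w).ShortExact where
  exact := (exact_iff_app _).2 h.exact
  mono_f := mono_of_injective h.inj
  epi_g := epi_of_surjective h.surj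

lemma exists_lift (h : IsSES f g) {X : C ⥤ ModuleCat.{u} k} (q : X ⟶ B) (hq : q ≫ g = 0) :
    ∃ l : X ⟶ A, l ≫ f = q := by
  have := h.shortExact.mono_f
  exact ⟨h.shortExact.exact.lift q hq, h.shortExact.exact.lift_f q hq⟩

lemma exists_desc (h : IsSES f g) {X : C ⥤ ModuleCat.{u} k} (q : B ⟶ X) (hq : f ≫ q = 0) :
    ∃ l : D ⟶ X, g ≫ l = q := by
  have := h.shortExact.epi_g
  exact ⟨h.shortExact.exact.desc q hq, h.shortExact.exact.g_desc q hq⟩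

end IsSES

lemma isSES_kernel (g : B ⟶ D) (hg : ∀ n, Function.Surjective (g.app n)) :
    IsSES (kernel.ι g) g where
  inj := injective_of_mono _
  exact := (exact_iff_app (ShortComplex.mk _ _ (kernel.condition g))).1
    (ShortComplex.exact_kernel g)
  surj := hg

lemma exact_kernel_app (g : B ⟶ D) (n : C) :
    Function.Exact ((kernel.ι g).app n) (g.app n) :=
  (exact_iff_app (ShortComplex.mk _ _ (kernel.condition g))).1 (ShortComplex.exact_kernel g) n

lemma exact_cokernel_app (f : A ⟶ B) (n : C) :
    Function.Exact (f.app n) ((cokernel.π f).app n) :=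
  (exact_iff_app (ShortComplex.mk _ _ (cokernel.condition f))).1 (ShortComplex.exact_cokernel f) n

lemma isSES_cokernel (f : A ⟶ B) (hf : ∀ n, Function.Injective (f.app n)) :
    IsSES f (cokernel.π f) where
  inj := hf
  exact := exact_cokernel_app f
  surj := surjective_of_epi _

/-- The kernel of a composite of two surjections is an extension of the kernels. -/
lemma exists_isSES_of_comp {K L W : C ⥤ ModuleCat.{u} k} {i : K ⟶ A} {f : A ⟶ B} {g : B ⟶ D}
    {j : L ⟶ A} {w : W ⟶ B} (hf : IsSES i f) (hg : IsSES w g) (hfg : IsSES j (f ≫ g)) :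
    ∃ (a : K ⟶ L) (b : L ⟶ W), IsSES a b ∧ a ≫ j = i ∧ b ≫ w = j ≫ f := by
  obtain ⟨a, ha⟩ := hfg.exists_lift i (by rw [← Category.assoc, hf.w, zero_comp])
  obtain ⟨b, hb⟩ := hg.exists_lift (j ≫ f) (by rw [Category.assoc, hfg.w])
  have ha' : ∀ n x, j.app n (a.app n x) = i.app n x := fun n x => by
    rw [← comp_app_apply, ha]
  have hb' : ∀ n x, w.app n (b.app n x) = f.app n (j.app n x) := fun n x => by
    rw [← comp_app_apply, hb, comp_app_apply]
  refine ⟨a, b, ⟨fun n x y hxy => hf.inj n ?_, fun n x => ⟨fun hx => ?_, ?_⟩, fun n x => ?_⟩,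
    ha, hb⟩
  · rw [← ha', ← ha', hxy]
  · have h1 : f.app n (j.app n x) = 0 := by rw [← hb', hx, map_zero]
    obtain ⟨y, hy⟩ := (hf.exact n _).1 h1
    exact ⟨y, hfg.inj n (by rw [ha', hy])⟩
  · rintro ⟨y, rfl⟩
    apply hg.inj n
    rw [hb', ha', map_zero, (hf.exact n).apply_apply_eq_zero]
  · obtain ⟨y, hy⟩ := hf.surj n (w.app n x)
    have h1 : (f ≫ g).app n y = 0 := by
      rw [comp_app_apply, hy, (hg.exact n).apply_apply_eq_zero]
    obtain ⟨z, hz⟩ := (hfg.exact n _).1 h1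
    exact ⟨z, hg.inj n (by rw [hb', hz, hy])⟩

end Exactness

/-! ### Generation by a class of objects -/

section Generation

variable {k : Type u} [CommRing k] {C : Type u} [SmallCategory C]

/-- The part of `V` at `n` that is generated by the values of `V` at the objects satisfying `S`. -/
def generated (S : C → Prop) (V : C ⥤ ModuleCat.{u} k) (n : C) : Submodule k (V.obj n) :=
  ⨆ (r : C) (_ : S r) (f : r ⟶ n), LinearMap.range (V.map f).hom

/-- `V` is generated by its values at the objects satisfying `S`. -/
def GenBy (S : C → Prop) (V : C ⥤ ModuleCat.{u} k) : Prop :=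
  ∀ n (v : V.obj n), v ∈ generated S V n

variable {S T : C → Prop} {V W X : C ⥤ ModuleCat.{u} k}

lemma map_mem_generated {r n : C} (hr : S r) (f : r ⟶ n) (v : V.obj r) :
    V.map f v ∈ generated S V n :=
  Submodule.mem_iSup_of_mem r <| Submodule.mem_iSup_of_mem hr <|
    Submodule.mem_iSup_of_mem f ⟨v, rfl⟩

lemma generated_le {n : C} {N : Submodule k (V.obj n)}
    (h : ∀ r, S r → ∀ (f : r ⟶ n) (v : V.obj r), V.map f v ∈ N) : generated S V n ≤ N := by
  refine iSup_le fun r => iSup_le fun hr => iSup_le fun f => ?_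
  rintro _ ⟨v, rfl⟩
  exact h r hr f v

lemma map_generated_mem {m n : C} (g : m ⟶ n) {v : V.obj m} (hv : v ∈ generated S V m) :
    V.map g v ∈ generated S V n := by
  have : generated S V m ≤ (generated S V n).comap (V.map g).hom :=
    generated_le fun r hr f v => by
      change V.map g (V.map f v) ∈ generated S V n
      rw [← ConcreteCategory.comp_apply, ← V.map_comp]
      exact map_mem_generated hr _ v
  exact this hv

lemma app_mem_generated (h : V ⟶ W) {n : C} {v : V.obj n} (hv : v ∈ generated S V n) :
    h.app n v ∈ generated S W n := by
  have : generated S V n ≤ (generated S W n).comap (h.app n).hom :=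
    generated_le fun r hr f v => by
      change h.app n (V.map f v) ∈ generated S W n
      rw [naturality_apply]
      exact map_mem_generated hr _ _
  exact this hv

lemma generated_mono (h : ∀ r, S r → T r) (n : C) : generated S V n ≤ generated T V n :=
  generated_le fun _ hr f v => map_mem_generated (h _ hr) f v

lemma GenBy.mono (hV : GenBy S V) (h : ∀ r, S r → T r) : GenBy T V :=
  fun n v => generated_mono h n (hV n v)

lemma GenBy.of_surjective (hV : GenBy S V) (h : V ⟶ W)
    (hs : ∀ n, Function.Surjective (h.app n)) : GenBy S W := fun n w => by
  obtain ⟨v, rfl⟩ := hs n w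
  exact app_mem_generated h (hV n v)

lemma mem_generated_of_exact {i : V ⟶ W} {p : W ⟶ X} {n : C}
    (he : ∀ m, Function.Exact (i.app m) (p.app m)) (hp : ∀ n, Function.Surjective (p.app n))
    (hV : ∀ v, v ∈ generated S V n) (hX : ∀ x, x ∈ generated S X n) (w : W.obj n) :
    w ∈ generated S W n := by
  have h1 : generated S X n ≤ (generated S W n).map (p.app n).hom :=
    generated_le fun r hr f x => by
      obtain ⟨y, rfl⟩ := hp r x
      exact ⟨W.map f y, map_mem_generated hr f y, naturality_apply p f y⟩
  obtain ⟨w', hw', hww⟩ := h1 (hX (p.app n w))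
  have h2 : p.app n (w - w') = 0 := by
    rw [map_sub, sub_eq_zero]
    exact hww.symm
  obtain ⟨v, hv⟩ := (he n _).1 h2
  rw [← sub_add_cancel w w', ← hv]
  exact add_mem (app_mem_generated i (hV v)) hw'

lemma GenBy.extension {i : V ⟶ W} {p : W ⟶ X} (he : ∀ n, Function.Exact (i.app n) (p.app n))
    (hp : ∀ n, Function.Surjective (p.app n)) (hV : GenBy S V) (hX : GenBy S X) : GenBy S W :=
  fun n => mem_generated_of_exact he hp (hV n) (hX n)

/-- Generation in ranks below some bound. -/
def GFD (rk : C → ℕ) (V : C ⥤ ModuleCat.{u} k) : Prop :=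
  ∃ N, GenBy (fun r => rk r < N) V

variable {rk : C → ℕ}

lemma GFD.of_surjective (hV : GFD rk V) (h : V ⟶ W)
    (hs : ∀ n, Function.Surjective (h.app n)) : GFD rk W :=
  ⟨_, hV.choose_spec.of_surjective h hs⟩

lemma GFD.extension {i : V ⟶ W} {p : W ⟶ X} (he : ∀ n, Function.Exact (i.app n) (p.app n))
    (hp : ∀ n, Function.Surjective (p.app n)) (hV : GFD rk V) (hX : GFD rk X) : GFD rk W := by
  obtain ⟨M, hM⟩ := hV
  obtain ⟨N, hN⟩ := hX
  exact ⟨max M N, (hM.mono fun r hr => lt_max_of_lt_left hr).extension he hp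
    (hN.mono fun r hr => lt_max_of_lt_right hr)⟩

end Generation

/-! ### Free modules on set-valued functors -/

section Free

variable {C : Type u} [SmallCategory C]

/-- The coproduct of the representable functors `C(n i, -)`. -/
def reprSum {I : Type u} (n : I → C) : C ⥤ Type u where
  obj x := Σ i, (n i ⟶ x)
  map f := ↾fun p => ⟨p.1, p.2 ≫ f⟩

variable (k : Type u) [CommRing k]

/-- The free module on a set-valued functor. -/
noncomputable def freeOn (F : C ⥤ Type u) : C ⥤ ModuleCat.{u} k := F ⋙ ModuleCat.free k

variable {k} {F : C ⥤ Type u}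

/-- The basis element of a free module attached to an element of the set-valued functor. -/
noncomputable def basisElt (k : Type u) [CommRing k] {F : C ⥤ Type u} {x : C} (a : F.obj x) :
    (freeOn k F).obj x := ModuleCat.freeMk a

lemma map_basisElt {x y : C} (f : x ⟶ y) (a : F.obj x) :
    (freeOn k F).map f (basisElt k a) = basisElt k (F.map f a) :=
  ModuleCat.free_map_apply _ _

/-- The homomorphism out of a free module determined by its values on the basis. -/
noncomputable def freeOnDesc {V : C ⥤ ModuleCat.{u} k} (φ : ∀ x, F.obj x → V.obj x)
    (hφ : ∀ {x y : C} (f : x ⟶ y) (a : F.obj x), φ y (F.map f a) = V.map f (φ x a)) :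
    freeOn k F ⟶ V where
  app x := ModuleCat.freeDesc (↾(φ x))
  naturality x y f := by
    apply ModuleCat.free_hom_ext
    intro a
    refine Eq.trans (b := φ y (F.map f a)) ?_ ?_
    · change ModuleCat.freeDesc _ ((freeOn k F).map f (basisElt k a)) = _
      rw [map_basisElt]
      exact ModuleCat.freeDesc_apply _ _
    · rw [hφ]
      exact congrArg (V.map f) (ModuleCat.freeDesc_apply (↾(φ x)) a).symm

lemma freeOnDesc_basisElt {V : C ⥤ ModuleCat.{u} k} (φ : ∀ x, F.obj x → V.obj x)
    (hφ : ∀ {x y : C} (f : x ⟶ y) (a : F.obj x), φ y (F.map f a) = V.map f (φ x a))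
    (x : C) (a : F.obj x) : (freeOnDesc φ hφ).app x (basisElt k a) = φ x a :=
  ModuleCat.freeDesc_apply _ _

lemma freeOn_hom_ext {V : C ⥤ ModuleCat.{u} k} {f g : freeOn k F ⟶ V}
    (h : ∀ x (a : F.obj x), f.app x (basisElt k a) = g.app x (basisElt k a)) :
    f = g := by
  ext x : 2
  exact ModuleCat.free_hom_ext (h x)

lemma freeOn_le {x : C} {N : Submodule k ((freeOn k F).obj x)}
    (h : ∀ a : F.obj x, basisElt k a ∈ N) (v : (freeOn k F).obj x) : v ∈ N := by
  change F.obj x →₀ k at v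
  induction v using Finsupp.induction_linear with
  | zero => exact N.zero_mem
  | add f g hf hg => exact N.add_mem hf hg
  | single a c =>
    have h1 : (Finsupp.single a c : F.obj x →₀ k) = c • Finsupp.single a 1 := by simp
    rw [h1]
    exact N.smul_mem c (h a)

end Free

/-! ### Direct sums of representable modules and their projectivity -/

section Free

variable {k : Type u} [CommRing k] {C : Type u} [SmallCategory C]

/-- The basis element of a sum of representable functors given by a morphism. -/
def reprMk {I : Type u} (n : I → C) {x : C} (i : I) (f : n i ⟶ x) : (reprSum n).obj x := ⟨i, f⟩

lemma map_reprMk {I : Type u} (n : I → C) {x y : C} (i : I) (f : n i ⟶ x) (g : x ⟶ y) :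
    (reprSum n).map g (reprMk n i f) = reprMk n i (f ≫ g) := rfl

lemma map_comp_apply (V : C ⥤ ModuleCat.{u} k) {x y z : C} (f : x ⟶ y) (g : y ⟶ z)
    (v : V.obj x) : V.map (f ≫ g) v = V.map g (V.map f v) := by
  rw [V.map_comp]
  rfl

/-- The homomorphism out of a direct sum of modules `M(n i)` sending the generators to given
elements. -/
noncomputable def reprDesc {I : Type u} (n : I → C) {V : C ⥤ ModuleCat.{u} k}
    (v : ∀ i, V.obj (n i)) : freeOn k (reprSum n) ⟶ V :=
  freeOnDesc (fun _ p => V.map p.2 (v p.1)) fun f a => map_comp_apply V a.2 f _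

lemma reprDesc_basisElt {I : Type u} (n : I → C) {V : C ⥤ ModuleCat.{u} k}
    (v : ∀ i, V.obj (n i)) {x : C} (i : I) (f : n i ⟶ x) :
    (reprDesc n v).app x (basisElt k (reprMk n i f)) = V.map f (v i) :=
  freeOnDesc_basisElt (F := reprSum n) (fun _ p => V.map p.2 (v p.1))
    (fun f a => map_comp_apply V a.2 f _) _ _

/-- The `i`-th generator of a direct sum of modules `M(n i)`. -/
noncomputable def reprGen (k : Type u) [CommRing k] {I : Type u} (n : I → C) (i : I) :
    (freeOn k (reprSum n)).obj (n i) :=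
  basisElt k (reprMk n i (𝟙 _))

lemma map_reprGen {I : Type u} (n : I → C) {x : C} (i : I) (f : n i ⟶ x) :
    (freeOn k (reprSum n)).map f (reprGen k n i) = basisElt k (reprMk n i f) := by
  rw [reprGen, map_basisElt, map_reprMk, Category.id_comp]

lemma reprDesc_reprGen {I : Type u} (n : I → C) {V : C ⥤ ModuleCat.{u} k}
    (v : ∀ i, V.obj (n i)) (i : I) : (reprDesc n v).app _ (reprGen k n i) = v i := by
  rw [reprGen, reprDesc_basisElt, V.map_id]
  rfl

lemma reprSum_hom_ext {I : Type u} {n : I → C} {V : C ⥤ ModuleCat.{u} k}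
    {f g : freeOn k (reprSum n) ⟶ V}
    (h : ∀ i, f.app _ (reprGen k n i) = g.app _ (reprGen k n i)) : f = g := by
  apply freeOn_hom_ext
  intro x a
  change f.app x (basisElt k (reprMk n a.1 a.2)) = g.app x (basisElt k (reprMk n a.1 a.2))
  rw [← map_reprGen, naturality_apply, naturality_apply, h]

lemma genBy_reprSum {S : C → Prop} {I : Type u} {n : I → C} (h : ∀ i, S (n i)) :
    GenBy S (freeOn k (reprSum n)) := fun x => by
  apply freeOn_le
  intro a
  change basisElt k (reprMk n a.1 a.2) ∈ _
  rw [← map_reprGen]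
  exact map_mem_generated (h a.1) _ _

instance projective_reprSum {I : Type u} (n : I → C) : Projective (freeOn k (reprSum n)) where
  factors {X Y} f e he := by
    choose v hv using fun i => surjective_of_epi e (n i) (f.app _ (reprGen k n i))
    refine ⟨reprDesc n v, reprSum_hom_ext fun i => ?_⟩
    rw [comp_app_apply, reprDesc_reprGen, hv]

/-- A set-valued functor with a basis gives a projective module. -/
lemma projective_of_basis {F : C ⥤ Type u} {I : Type u} (n : I → C) (e : ∀ i, F.obj (n i))
    (h : ∀ x, Function.Bijective fun p : Σ i, (n i ⟶ x) => F.map p.2 (e p.1)) :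
    Projective (freeOn k F) := by
  let φ : reprSum n ⟶ F :=
    { app x := ↾fun p : Σ i, (n i ⟶ x) => F.map p.2 (e p.1)
      naturality x y f := by
        ext p
        change F.map (p.2 ≫ f) (e p.1) = F.map f (F.map p.2 (e p.1))
        rw [F.map_comp]
        rfl }
  have : IsIso φ := by
    rw [NatTrans.isIso_iff_isIso_app]
    intro x
    rw [isIso_iff_bijective]
    exact h x
  exact Projective.of_iso (Functor.isoWhiskerRight (asIso φ) (ModuleCat.free k))
    (projective_reprSum n)

/-- The generator of the free module `M(n)`. -/
noncomputable def freeGen (k : Type u) [CommRing k] (n : C) : (freeModule k n).obj n :=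
  basisElt k (F := coyoneda.obj (Opposite.op n)) (𝟙 n)

/-- The homomorphism out of `M(n)` sending the generator to a given element. -/
noncomputable def freeModuleDesc {n : C} {V : C ⥤ ModuleCat.{u} k} (v : V.obj n) :
    freeModule k n ⟶ V :=
  freeOnDesc (F := coyoneda.obj (Opposite.op n)) (fun _ f => V.map f v) fun f a =>
    map_comp_apply V a f _

lemma freeModuleDesc_freeGen {n : C} {V : C ⥤ ModuleCat.{u} k} (v : V.obj n) :
    (freeModuleDesc v).app n (freeGen k n) = v := by
  rw [freeModuleDesc, freeGen]
  refine (freeOnDesc_basisElt (F := coyoneda.obj (Opposite.op n)) (fun _ f => V.map f v)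
    (fun f a => map_comp_apply V a f _) _ _).trans ?_
  rw [V.map_id]
  rfl

lemma map_freeGen {n x : C} (f : n ⟶ x) : (freeModule k n).map f (freeGen k n) =
    basisElt k (F := coyoneda.obj (Opposite.op n)) f := by
  refine (map_basisElt (F := coyoneda.obj (Opposite.op n)) _ _).trans ?_
  congr 1
  exact Category.id_comp f

lemma freeModule_hom_ext {n : C} {V : C ⥤ ModuleCat.{u} k} {f g : freeModule k n ⟶ V}
    (h : f.app n (freeGen k n) = g.app n (freeGen k n)) : f = g := by
  apply freeOn_hom_ext (F := coyoneda.obj (Opposite.op n))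
  intro x a
  have h1 := naturality_apply f a (freeGen k n)
  have h2 := naturality_apply g a (freeGen k n)
  rw [map_freeGen] at h1 h2
  exact h1.trans ((congrArg _ h).trans h2.symm)

lemma projective_freeModule (n : C) : Projective (freeModule k n) where
  factors {X Y} f e he := by
    obtain ⟨v, hv⟩ := surjective_of_epi e n (f.app _ (freeGen k n))
    refine ⟨freeModuleDesc v, freeModule_hom_ext ?_⟩
    rw [comp_app_apply, freeModuleDesc_freeGen, hv]

/-- A module generated by `S` is covered by a direct sum of modules `M(n)` with `S n`. -/
lemma GenBy.exists_cover {S : C → Prop} {V : C ⥤ ModuleCat.{u} k} (hV : GenBy S V) :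
    ∃ (I : Type u) (n : I → C) (p : freeOn k (reprSum n) ⟶ V),
      (∀ i, S (n i)) ∧ ∀ x, Function.Surjective (p.app x) := by
  let I := Σ r : {r // S r}, V.obj r
  let n : I → C := fun i => i.1.1
  let p : freeOn k (reprSum n) ⟶ V := reprDesc n fun i => i.2
  refine ⟨I, n, p, fun i => i.1.2, fun x v => ?_⟩
  have : generated S V x ≤ LinearMap.range (p.app x).hom := generated_le fun r hr f w =>
    ⟨basisElt k (reprMk n ⟨⟨r, hr⟩, w⟩ f), reprDesc_basisElt n (fun i => i.2) ⟨⟨r, hr⟩, w⟩ f⟩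
  exact this (hV x v)

/-- The two models of a direct sum of modules `M(n i)` are isomorphic. -/
noncomputable def sigmaIso (k : Type u) [CommRing k] {I : Type u} (n : I → C) :
    (∐ fun i => freeModule k (n i)) ≅ freeOn k (reprSum n) where
  hom := Sigma.desc fun i => freeModuleDesc (reprGen k n i)
  inv := reprDesc n fun i => (Sigma.ι (fun i => freeModule k (n i)) i).app (n i) (freeGen k (n i))
  hom_inv_id := by
    apply Sigma.hom_ext
    intro i
    rw [Sigma.ι_desc_assoc, Category.comp_id]
    apply freeModule_hom_ext
    rw [comp_app_apply, freeModuleDesc_freeGen, reprDesc_reprGen]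
  inv_hom_id := by
    apply reprSum_hom_ext
    intro i
    rw [comp_app_apply, reprDesc_reprGen, ← comp_app_apply, Sigma.ι_desc, freeModuleDesc_freeGen]
    rfl

end Free

/-! ### Finite presentation and coherence -/

section Presented

variable {k : Type u} [CommRing k] {C : Type u} [SmallCategory C] {rk : C → ℕ}

/-- `V` is generated in finite degrees, and so is the kernel of every surjection onto `V` from
a module generated in finite degrees. -/
structure FP (rk : C → ℕ) (V : C ⥤ ModuleCat.{u} k) : Prop where
  gfd : GFD rk V
  ker : ∀ {K X : C ⥤ ModuleCat.{u} k} {i : K ⟶ X} {p : X ⟶ V}, IsSES i p → GFD rk X → GFD rk K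

variable {A B D K P V W X : C ⥤ ModuleCat.{u} k}

lemma GFD.exists_cover (hV : GFD rk V) :
    ∃ (I : Type u) (n : I → C) (p : freeOn k (reprSum n) ⟶ V),
      GFD rk (freeOn k (reprSum n)) ∧ ∀ x, Function.Surjective (p.app x) := by
  obtain ⟨N, hN⟩ := hV
  obtain ⟨I, n, p, hn, hp⟩ := hN.exists_cover
  exact ⟨I, n, p, ⟨N, genBy_reprSum hn⟩, hp⟩

/-- The kernel of one surjection from a projective module suffices to detect `FP`. -/
lemma FP.of_presentation [Projective P] {i : K ⟶ P} {p : P ⟶ V} (h : IsSES i p)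
    (hV : GFD rk V) (hK : GFD rk K) : FP rk V where
  gfd := hV
  ker {L X j q} h' hX := by
    have := epi_of_surjective h'.surj
    -- Schanuel comparison: with `l` over `V`, the kernel `L` of `X → V` is an extension of `coker
    -- l`, a quotient of `X`, by a quotient of `K`.
    obtain ⟨l, hl⟩ : ∃ l : P ⟶ X, l ≫ q = p := ⟨_, Projective.factorThru_comp p q⟩
    have hl' : ∀ n x, q.app n (l.app n x) = p.app n x := fun n x => by
      rw [← comp_app_apply, hl]
    obtain ⟨a, ha⟩ := h'.exists_lift (i ≫ l) (by rw [Category.assoc, hl, h.w])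
    have ha' : ∀ n x, j.app n (a.app n x) = l.app n (i.app n x) := fun n x => by
      rw [← comp_app_apply, ha, comp_app_apply]
    refine GFD.extension (i := a) (p := j ≫ cokernel.π l) (fun n x => ⟨fun hx => ?_, ?_⟩)
      (fun n z => ?_) hK (hX.of_surjective (cokernel.π l) (surjective_of_epi _))
    · obtain ⟨y, hy⟩ : ∃ y, l.app n y = j.app n x := (exact_cokernel_app l n _).1 hx
      have : p.app n y = 0 := by rw [← hl', hy, (h'.exact n).apply_apply_eq_zero]
      obtain ⟨w, rfl⟩ := (h.exact n _).1 this
      exact ⟨w, h'.inj n (by rw [ha', hy])⟩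
    · rintro ⟨y, rfl⟩
      rw [comp_app_apply, ha', (exact_cokernel_app l n).apply_apply_eq_zero]
    · obtain ⟨x, rfl⟩ := surjective_of_epi (cokernel.π l) n z
      obtain ⟨y, hy⟩ := h.surj n (q.app n x)
      have : q.app n (x - l.app n y) = 0 := by rw [map_sub, hl', hy, sub_self]
      obtain ⟨w, hw⟩ := (h'.exact n _).1 this
      refine ⟨w, ?_⟩
      rw [comp_app_apply, hw, map_sub, (exact_cokernel_app l n).apply_apply_eq_zero, sub_zero]

lemma gfd_of_subsingleton (h : ∀ n, Subsingleton (V.obj n)) : GFD rk V :=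
  ⟨0, fun n v => by
    rw [(h n).elim v 0]
    exact zero_mem _⟩

lemma FP.of_iso (e : V ≅ W) (hV : FP rk V) : FP rk W where
  gfd := hV.gfd.of_surjective e.hom (surjective_of_epi _)
  ker {K X i p} h hX := by
    refine hV.ker (i := i) (p := p ≫ e.inv) ⟨h.inj, fun n x => ?_, fun n =>
      (surjective_of_epi e.inv n).comp (h.surj n)⟩ hX
    rw [← h.exact n x, comp_app_apply]
    exact map_eq_zero_iff (e.inv.app n).hom (injective_of_mono e.inv n)

lemma FP.of_bijective (f : W ⟶ V) (hf : ∀ n, Function.Bijective (f.app n)) (hV : FP rk V) :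
    FP rk W := by
  have := mono_of_injective fun n => (hf n).1
  have := epi_of_surjective fun n => (hf n).2
  have := isIso_of_mono_of_epi f
  exact hV.of_iso (asIso f).symm

lemma GFD.fp_of_projective [Projective V] (h : GFD rk V) : FP rk V := by
  refine FP.of_presentation (isSES_kernel (𝟙 V) fun n x => ⟨x, rfl⟩) h
    (gfd_of_subsingleton fun n => ⟨fun x y => injective_of_mono (kernel.ι (𝟙 V)) n ?_⟩)
  exact ((exact_kernel_app (𝟙 V) n).apply_apply_eq_zero x).trans
    ((exact_kernel_app (𝟙 V) n).apply_apply_eq_zero y).symm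

/-- For a surjection `X → B`, the kernel of `X → B → D` is generated in finite degrees because `D`
is FP, and it surjects onto `A` with kernel that of `X → B`. -/
lemma FP.extension {i : A ⟶ B} {p : B ⟶ D} (h : IsSES i p) (hA : FP rk A) (hD : FP rk D) :
    FP rk B where
  gfd := hA.gfd.extension h.exact h.surj hD.gfd
  ker {K X j q} h' hX := by
    have hs : ∀ n, Function.Surjective ((q ≫ p).app n) := fun n =>
      (h.surj n).comp (h'.surj n)
    obtain ⟨a, b, hab, -, -⟩ := exists_isSES_of_comp h' h (isSES_kernel (q ≫ p) hs)
    exact hA.ker hab (hD.ker (isSES_kernel (q ≫ p) hs) hX)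

/-- The relations of `D` on a free cover of `B` are an extension of `A` by the relations of `B`, so
`A` need only be generated in finite degrees. -/
lemma FP.quotient {i : A ⟶ B} {p : B ⟶ D} (h : IsSES i p) (hA : GFD rk A) (hB : FP rk B) :
    FP rk D := by
  obtain ⟨I, n, q, hP, hq⟩ := hB.gfd.exists_cover
  have hs : ∀ n, Function.Surjective ((q ≫ p).app n) := fun n => (h.surj n).comp (hq n)
  obtain ⟨a, b, hab, -, -⟩ := exists_isSES_of_comp (isSES_kernel q hq) h
    (isSES_kernel (q ≫ p) hs)
  exact FP.of_presentation (isSES_kernel (q ≫ p) hs) (hB.gfd.of_surjective p h.surj)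
    ((hB.ker (isSES_kernel q hq) hP).extension hab.exact hab.surj hA)

/-- The kernel of every surjection between modules presented in finite degrees is presented in
finite degrees. -/
def Coherent (k : Type u) [CommRing k] (rk : C → ℕ) : Prop :=
  ∀ ⦃W X V : C ⥤ ModuleCat.{u} k⦄ (i : W ⟶ X) (p : X ⟶ V), IsSES i p → FP rk X → FP rk V → FP rk W

lemma Coherent.fp_of_injective (h : Coherent k rk) (i : W ⟶ X)
    (hi : ∀ n, Function.Injective (i.app n)) (hW : GFD rk W) (hX : FP rk X) : FP rk W :=
  h i (cokernel.π i) (isSES_cokernel i hi) hX (hX.quotient (isSES_cokernel i hi) hW)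

lemma generatedInFiniteDegrees_iff : GeneratedInFiniteDegrees rk V ↔ GFD rk V := by
  constructor
  · rintro ⟨N, I, n, p, hn, hp⟩
    have h1 : GFD rk (freeOn k (reprSum n)) := ⟨N, genBy_reprSum hn⟩
    exact h1.of_surjective ((sigmaIso k n).inv ≫ p) (surjective_of_epi _)
  · rintro ⟨N, hN⟩
    obtain ⟨I, n, p, hn, hp⟩ := hN.exists_cover
    have := epi_of_surjective hp
    exact ⟨N, I, n, (sigmaIso k n).hom ≫ p, hn, inferInstance⟩

lemma presentedInFiniteDegrees_iff : PresentedInFiniteDegrees rk V ↔ FP rk V := by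
  constructor
  · rintro ⟨I, n, p, hp, hV, hK⟩
    have : ∀ i, Projective (freeModule k (n i)) := fun i => projective_freeModule _
    exact FP.of_presentation (isSES_kernel p (surjective_of_epi p))
      (generatedInFiniteDegrees_iff.1 hV) (generatedInFiniteDegrees_iff.1 hK)
  · intro h
    obtain ⟨N, I, n, p, hn, hp⟩ := generatedInFiniteDegrees_iff.2 h.gfd
    refine ⟨I, n, p, hp, generatedInFiniteDegrees_iff.2 h.gfd, generatedInFiniteDegrees_iff.2 ?_⟩
    exact h.ker (isSES_kernel p (surjective_of_epi p))
      (generatedInFiniteDegrees_iff.1 ⟨N, I, n, 𝟙 _, hn, inferInstance⟩)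

end Presented

/-! ### The derivative of a module along a shift -/

section Shift

variable {k : Type u} [CommRing k] {C : Type u} [SmallCategory C] {ψ : C ⥤ C} (ε : 𝟭 C ⟶ ψ)
variable {A B D V W : C ⥤ ModuleCat.{u} k}

/-- The derivative of `V`: the cokernel of the map from `V` to its shift. -/
noncomputable def deriv (V : C ⥤ ModuleCat.{u} k) : C ⥤ ModuleCat.{u} k := cokernel (toShift ε V)

/-- The projection from the shift of `V` to its derivative. -/
noncomputable def derivπ (V : C ⥤ ModuleCat.{u} k) : ψ ⋙ V ⟶ deriv ε V := cokernel.π _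

/-- `ε` acts injectively on `V`. -/
def TorsionFree (V : C ⥤ ModuleCat.{u} k) : Prop := ∀ n, Function.Injective ((toShift ε V).app n)

variable {ε}

lemma derivπ_surjective (V : C ⥤ ModuleCat.{u} k) (n : C) :
    Function.Surjective ((derivπ ε V).app n) := surjective_of_epi (cokernel.π (toShift ε V)) n

lemma derivπ_exact (V : C ⥤ ModuleCat.{u} k) (n : C) :
    Function.Exact ((toShift ε V).app n) ((derivπ ε V).app n) := exact_cokernel_app _ n

lemma derivπ_toShift (V : C ⥤ ModuleCat.{u} k) (n : C) (v : V.obj n) :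
    (derivπ ε V).app n ((toShift ε V).app n v) = 0 :=
  (derivπ_exact V n).apply_apply_eq_zero v

lemma TorsionFree.isSES (h : TorsionFree ε V) : IsSES (toShift ε V) (derivπ ε V) :=
  isSES_cokernel _ h

lemma toShift_naturality (f : V ⟶ W) :
    toShift ε V ≫ Functor.whiskerLeft ψ f = f ≫ toShift ε W := by
  ext n v
  exact (naturality_apply f (ε.app n) v)

lemma toShift_naturality_apply (f : V ⟶ W) (n : C) (v : V.obj n) :
    f.app (ψ.obj n) ((toShift ε V).app n v) = (toShift ε W).app n (f.app n v) :=
  naturality_apply f (ε.app n) v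

variable (ε) in
/-- The homomorphism between derivatives induced by a homomorphism. -/
noncomputable def derivMap (f : V ⟶ W) : deriv ε V ⟶ deriv ε W :=
  cokernel.map _ _ f (Functor.whiskerLeft ψ f) (toShift_naturality f)

lemma derivπ_derivMap (f : V ⟶ W) :
    derivπ ε V ≫ derivMap ε f = Functor.whiskerLeft ψ f ≫ derivπ ε W :=
  cokernel.π_desc _ _ _

lemma derivMap_derivπ_apply (f : V ⟶ W) (n : C) (v : V.obj (ψ.obj n)) :
    (derivMap ε f).app n ((derivπ ε V).app n v) = (derivπ ε W).app n (f.app (ψ.obj n) v) := by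
  rw [← comp_app_apply, derivπ_derivMap]
  rfl

lemma derivMap_surjective {f : V ⟶ W} (hf : ∀ n, Function.Surjective (f.app n)) (n : C) :
    Function.Surjective ((derivMap ε f).app n) := fun z => by
  obtain ⟨w, rfl⟩ := derivπ_surjective W n z
  obtain ⟨v, rfl⟩ := hf _ w
  exact ⟨_, derivMap_derivπ_apply f n v⟩

lemma derivMap_exact {f : A ⟶ B} {g : B ⟶ D} (h : IsSES f g) (n : C) :
    Function.Exact ((derivMap ε f).app n) ((derivMap ε g).app n) := fun z => by
  constructor
  · intro hz
    obtain ⟨b, rfl⟩ := derivπ_surjective B n z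
    rw [derivMap_derivπ_apply] at hz
    obtain ⟨d, hd⟩ := (derivπ_exact D n _).1 hz
    obtain ⟨b', rfl⟩ := h.surj n d
    have : g.app _ (b - (toShift ε B).app n b') = 0 := by
      rw [map_sub, toShift_naturality_apply]
      exact sub_eq_zero.2 hd.symm
    obtain ⟨a, ha⟩ := (h.exact _ _).1 this
    refine ⟨(derivπ ε A).app n a, ?_⟩
    rw [derivMap_derivπ_apply, ha]
    exact (map_sub ((derivπ ε B).app n).hom _ _).trans
      ((congrArg _ (derivπ_toShift B n b')).trans (sub_zero _))
  · rintro ⟨y, rfl⟩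
    obtain ⟨a, rfl⟩ := derivπ_surjective A n y
    rw [derivMap_derivπ_apply, derivMap_derivπ_apply, (h.exact _).apply_apply_eq_zero]
    exact map_zero ((derivπ ε D).app n).hom

/-- By the snake lemma, injectivity on the left is obstructed only by elements of `D` killed by `ε`.
-/
lemma derivMap_isSES {f : A ⟶ B} {g : B ⟶ D} (h : IsSES f g) (hD : TorsionFree ε D) :
    IsSES (derivMap ε f) (derivMap ε g) where
  inj n := by
    refine (injective_iff_map_eq_zero ((derivMap ε f).app n).hom).2 fun z hz => ?_
    obtain ⟨a, rfl⟩ := derivπ_surjective A n z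
    have hz' : (derivMap ε f).app n ((derivπ ε A).app n a) = 0 := hz
    rw [derivMap_derivπ_apply] at hz'
    obtain ⟨b, hb⟩ := (derivπ_exact B n _).1 hz'
    have hb' : (toShift ε B).app n b = f.app _ a := hb
    have h1 : g.app n b = 0 := by
      apply hD n
      rw [← toShift_naturality_apply, hb', (h.exact _).apply_apply_eq_zero, map_zero]
    obtain ⟨a', rfl⟩ := (h.exact n _).1 h1
    rw [← toShift_naturality_apply] at hb'
    rw [← h.inj _ hb', derivπ_toShift]
  exact n := derivMap_exact h n
  surj := derivMap_surjective h.surj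

lemma TorsionFree.of_injective (f : V ⟶ W) (hf : ∀ n, Function.Injective (f.app n))
    (hW : TorsionFree ε W) : TorsionFree ε V := fun n x y hxy => by
  apply hf n
  apply hW n
  rw [← toShift_naturality_apply, ← toShift_naturality_apply, hxy]

/-- The kernel of the map between derivatives embeds into the part of the quotient killed
by `ε`. -/
lemma exists_kernel_derivMap {f : A ⟶ B} {g : B ⟶ D} (h : IsSES f g) (hB : TorsionFree ε B) :
    ∃ θ : kernel (derivMap ε f) ⟶ D, (∀ n, Function.Injective (θ.app n)) ∧
      θ ≫ toShift ε D = 0 := by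
  have hA := hB.of_injective f h.inj
  -- Inside the shift of `B`, `kernel q` is the intersection of the shift of `A` with `B`. Its
  -- quotient by `A` is the kernel of `derivMap ε f`, and sending it through `β` to `B` and then to
  -- `D` gives the connecting map `θ`.
  let q : ψ ⋙ A ⟶ deriv ε B := Functor.whiskerLeft ψ f ≫ derivπ ε B
  obtain ⟨β, hβ⟩ := hB.isSES.exists_lift (kernel.ι q ≫ Functor.whiskerLeft ψ f) (by
    rw [Category.assoc]; exact kernel.condition q)
  obtain ⟨τ, hτ⟩ : ∃ τ : kernel q ⟶ kernel (derivMap ε f),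
      τ ≫ kernel.ι _ = kernel.ι q ≫ derivπ ε A :=
    ⟨kernel.lift _ (kernel.ι q ≫ derivπ ε A) (by
      rw [Category.assoc, derivπ_derivMap]; exact kernel.condition q), kernel.lift_ι _ _ _⟩
  obtain ⟨α, hα⟩ : ∃ α : A ⟶ kernel q, α ≫ kernel.ι q = toShift ε A :=
    ⟨kernel.lift _ (toShift ε A) (by
      rw [← Category.assoc, toShift_naturality, Category.assoc, hB.isSES.w, comp_zero]),
      kernel.lift_ι _ _ _⟩
  have hτ' : ∀ n y, (kernel.ι (derivMap ε f)).app n (τ.app n y) =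
      (derivπ ε A).app n ((kernel.ι q).app n y) := fun n y => by
    rw [← comp_app_apply, hτ, comp_app_apply]
  have hα' : ∀ n y, (kernel.ι q).app n (α.app n y) = (toShift ε A).app n y := fun n y => by
    rw [← comp_app_apply, hα]
  have hβ' : ∀ n y, (toShift ε B).app n (β.app n y) = f.app _ ((kernel.ι q).app n y) :=
    fun n y => by
      rw [← comp_app_apply, hβ]
      rfl
  have hses : IsSES α τ := by
    refine ⟨fun n x y hxy => hA n ?_, fun n y => ⟨fun hy => ?_, ?_⟩, fun n t => ?_⟩
    · rw [← hα', ← hα', hxy]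
    · have h1 : (derivπ ε A).app n ((kernel.ι q).app n y) = 0 := by rw [← hτ', hy, map_zero]
      obtain ⟨a, ha⟩ := (derivπ_exact A n _).1 h1
      exact ⟨a, injective_of_mono (kernel.ι q) n ((hα' n a).trans ha)⟩
    · rintro ⟨a, rfl⟩
      apply injective_of_mono (kernel.ι (derivMap ε f)) n
      rw [hτ', hα', derivπ_toShift, map_zero]
    · obtain ⟨a, ha⟩ := derivπ_surjective A n ((kernel.ι (derivMap ε f)).app n t)
      have h1 : q.app n a = 0 := by
        change (derivπ ε B).app n (f.app _ a) = 0
        rw [← derivMap_derivπ_apply, ha]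
        exact (exact_kernel_app _ n).apply_apply_eq_zero t
      obtain ⟨y, hy⟩ := (exact_kernel_app q n a).1 h1
      refine ⟨y, injective_of_mono (kernel.ι (derivMap ε f)) n ?_⟩
      rw [hτ', ← ha]
      exact congrArg _ hy
  have hαβ : α ≫ β = f := by
    have := mono_of_injective hB
    rw [← cancel_mono (toShift ε B), Category.assoc, hβ, ← Category.assoc, hα, toShift_naturality]
  obtain ⟨θ, hθ⟩ := hses.exists_desc (β ≫ g) (by rw [← Category.assoc, hαβ, h.w])
  have hθ' : ∀ n y, θ.app n (τ.app n y) = g.app n (β.app n y) := fun n y => by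
    rw [← comp_app_apply, hθ, comp_app_apply]
  refine ⟨θ, fun n => (injective_iff_map_eq_zero (θ.app n).hom).2 fun t ht => ?_, ?_⟩
  · obtain ⟨y, rfl⟩ := hses.surj n t
    have h1 : g.app n (β.app n y) = 0 := (hθ' n y).symm.trans ht
    obtain ⟨a, ha⟩ := (h.exact n _).1 h1
    have h2 := hβ' n y
    rw [← ha, ← toShift_naturality_apply] at h2
    rw [← injective_of_mono (kernel.ι q) n ((hα' n a).trans (h.inj _ h2)),
      (hses.exact n).apply_apply_eq_zero]
  · have := hses.shortExact.epi_g
    rw [← cancel_epi τ, ← Category.assoc, hθ, Category.assoc, ← toShift_naturality,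
      ← Category.assoc, hβ, Category.assoc, ← Functor.whiskerLeft_comp, h.w]
    exact comp_zero.trans comp_zero.symm

/-- The value of `V` at a shifted object is generated by the lifts of generators of the
derivative together with the image of `V`. -/
lemma mem_generated_of_deriv {S S' : C → Prop} (hS : ∀ q, S q → S' (ψ.obj q)) {n : C}
    (hd : ∀ z, z ∈ generated S (deriv ε V) n) (hV : ∀ b, b ∈ generated S' V n)
    (v : V.obj (ψ.obj n)) : v ∈ generated S' V (ψ.obj n) := by
  have hle : generated S (deriv ε V) n ≤
      (generated S' V (ψ.obj n)).map ((derivπ ε V).app n).hom := generated_le fun q hq f w => by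
    obtain ⟨u, rfl⟩ := derivπ_surjective V q w
    exact ⟨V.map (ψ.map f) u, map_mem_generated (hS q hq) _ u, naturality_apply (derivπ ε V) f u⟩
  obtain ⟨v', hv', hvv⟩ : ∃ v' : V.obj (ψ.obj n), v' ∈ generated S' V (ψ.obj n) ∧
      (derivπ ε V).app n v' = (derivπ ε V).app n v := hle (hd ((derivπ ε V).app n v))
  have h2 : (derivπ ε V).app n (v - v') = 0 :=
    (map_sub ((derivπ ε V).app n).hom v v').trans (sub_eq_zero.2 hvv.symm)
  obtain ⟨b, hb⟩ := (derivπ_exact V n _).1 h2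
  have h3 : V.map (ε.app n) b = v - v' := hb
  have h4 : v - v' ∈ generated S' V (ψ.obj n) := h3 ▸ map_generated_mem (ε.app n) (hV b)
  have h5 := add_mem h4 hv'
  rwa [sub_add_cancel] at h5

end Shift

/-! ### Generation degree in one factor -/

section TypeA

variable {k : Type u} [CommRing k] {E : Type u} [SmallCategory E] {deg : E ≃ ℕ}

/-- In degrees at least `d` every element is decomposable, so strong induction on the degree
applies. For `d = 0` the bound is `-1` and the conclusion says that `V` vanishes. -/
lemma genBy_of_generationDegree {V : E ⥤ ModuleCat.{u} k} {d : ℕ}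
    (h : generationDegree deg V ≤ (d : EReal) - 1) : GenBy (fun r => deg r < d) V := by
  have key : ∀ m n, deg n = m → ∀ v : V.obj n, v ∈ generated (fun r => deg r < d) V n := by
    intro m
    induction m using Nat.strong_induction_on with
    | _ m ih =>
      intro n hn v
      by_cases hd : deg n < d
      · have := map_mem_generated (S := fun r => deg r < d) hd (𝟙 n) v
        rwa [V.map_id] at this
      · have hsub : Subsingleton (zerothHomology deg V n) := by
          by_contra hns
          have h1 : ((deg n : ℕ) : EReal) ≤ (d : EReal) - 1 :=
            le_trans (le_sSup (Set.mem_insert_of_mem (-1) (Set.mem_ofPred.2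
              ⟨n, not_subsingleton_iff_nontrivial.1 hns, rfl⟩))) h
          have h2 : ((d : ℕ) : EReal) - 1 = (((d : ℝ) - 1 : ℝ) : EReal) := by
            rw [EReal.coe_sub]
            rfl
          rw [h2, show ((deg n : ℕ) : EReal) = ((deg n : ℝ) : EReal) from rfl,
            EReal.coe_le_coe_iff] at h1
          have h3 : (d : ℝ) ≤ deg n := by exact_mod_cast not_lt.1 hd
          linarith
        have hv : v ∈ decomposables deg V n := by
          rw [← Submodule.Quotient.mk_eq_zero (decomposables deg V n)]
          exact hsub.elim _ _
        exact (generated_le fun r hr f w => map_generated_mem f (ih (deg r) (hn ▸ hr) r rfl w) :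
          generated (fun r => deg r < deg n) V n ≤ _) hv
  exact fun n v => key _ n rfl v

end TypeA

/-! ### Layers of a module over a product -/

section Product

open Prod

variable {k : Type u} [CommRing k] {D E : Type u} [SmallCategory D] [SmallCategory E]

/-- The restriction of a module over a product to the objects with a given second component. -/
abbrev layer (y : E) (V : D × E ⥤ ModuleCat.{u} k) : D ⥤ ModuleCat.{u} k := sectL D y ⋙ V

/-- The map between layers induced by a homomorphism. -/
abbrev layerMap (y : E) {V W : D × E ⥤ ModuleCat.{u} k} (f : V ⟶ W) : layer y V ⟶ layer y W :=
  Functor.whiskerLeft (sectL D y) f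

lemma IsSES.whiskerLeft {C C' : Type u} [SmallCategory C] [SmallCategory C']
    {U V W : C ⥤ ModuleCat.{u} k} {f : U ⟶ V} {g : V ⟶ W}
    (h : IsSES f g) (F : C' ⥤ C) : IsSES (Functor.whiskerLeft F f) (Functor.whiskerLeft F g) :=
  ⟨fun n => h.inj (F.obj n), fun n => h.exact (F.obj n), fun n => h.surj (F.obj n)⟩

/-- The rank on a product in which the second factor is graded by `deg`. -/
def prodRank (rk : D → ℕ) (deg : E → ℕ) (p : D × E) : ℕ := rk p.1 + deg p.2

variable {rk : D → ℕ} {deg : E ≃ ℕ} {V W T : D × E ⥤ ModuleCat.{u} k}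

lemma mkHom_factor {a x : D} {r y : E} (f : a ⟶ x) (g : r ⟶ y) :
    (f ×ₘ g : (a, r) ⟶ (x, y)) = (𝟙 a ×ₘ g) ≫ (f ×ₘ 𝟙 y) := by
  ext <;> simp

lemma GFD.layer (hV : GFD (prodRank rk deg) V) (y : E) : GFD rk (layer y V) := by
  obtain ⟨N, hN⟩ := hV
  refine ⟨N, fun x v => ?_⟩
  have : generated (fun p => prodRank rk deg p < N) V (x, y) ≤
      generated (fun r => rk r < N) (FinDeg.layer y V) x := generated_le fun p hp f w => by
    obtain ⟨a, r⟩ := p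
    obtain ⟨f, g⟩ := f
    change V.map (f ×ₘ g) w ∈ _
    rw [mkHom_factor, map_comp_apply]
    exact map_mem_generated (V := FinDeg.layer y V) (S := fun r => rk r < N)
      (lt_of_le_of_lt (Nat.le_add_right _ _) hp) f _
  exact this (hN _ v)

/-- The layer at `y` of `M(a, r)` is a direct sum of copies of `M(a)` indexed by the morphisms `r ⟶
y`. -/
lemma projective_layer {I : Type u} (n : I → D × E) (y : E) :
    Projective (layer y (freeOn k (reprSum n))) := by
  refine projective_of_basis (F := sectL D y ⋙ reprSum n) (I := Σ i, ((n i).2 ⟶ y))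
    (fun j => (n j.1).1)
    (fun j => (⟨j.1, (𝟙 (n j.1).1, j.2)⟩ : Σ i, (n i ⟶ ((n j.1).1, y)))) fun x => ?_
  have key : ∀ p : Σ j : (Σ i, ((n i).2 ⟶ y)), ((n j.1).1 ⟶ x),
      (sectL D y ⋙ reprSum n).map p.2
        (⟨p.1.1, (𝟙 (n p.1.1).1, p.1.2)⟩ : Σ i, (n i ⟶ ((n p.1.1).1, y))) =
        (⟨p.1.1, (p.2, p.1.2)⟩ : Σ i, (n i ⟶ (x, y))) := by
    rintro ⟨⟨i, g⟩, f⟩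
    change (⟨i, ((𝟙 _ ≫ f, g ≫ 𝟙 _) : n i ⟶ (x, y))⟩ : Σ i, (n i ⟶ (x, y))) = _
    rw [Category.id_comp, Category.comp_id]
  constructor
  · intro p q hpq
    have h := (key p).symm.trans (hpq.trans (key q))
    obtain ⟨⟨i, g⟩, f⟩ := p
    obtain ⟨⟨i', g'⟩, f'⟩ := q
    obtain ⟨rfl, h2⟩ := Sigma.mk.inj h
    obtain ⟨rfl, rfl⟩ := Prod.mk.inj (eq_of_heq h2)
    rfl
  · rintro ⟨i, f, g⟩
    exact ⟨⟨⟨i, g⟩, f⟩, key ⟨⟨i, g⟩, f⟩⟩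

lemma FP.layer (hV : FP (prodRank rk deg) V) (y : E) : FP rk (layer y V) := by
  obtain ⟨I, n, p, hP, hp⟩ := hV.gfd.exists_cover
  have := projective_layer (k := k) n y
  exact FP.of_presentation ((isSES_kernel p hp).whiskerLeft (sectL D y)) (hV.gfd.layer y)
    ((hV.ker (isSES_kernel p hp) hP).layer y)

/-- A module supported in finitely many layers, all presented in finite degrees, is presented in
finite degrees. -/
lemma fp_of_layers (hE : IsTransitiveTypeA deg) (hT : GFD (prodRank rk deg) T)
    (hl : ∀ y, FP rk (layer y T)) {N : ℕ} (h0 : ∀ x y, N ≤ deg y → Subsingleton (T.obj (x, y))) :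
    FP (prodRank rk deg) T := by
  obtain ⟨M, hM⟩ := hT
  obtain ⟨I, n, p, hn, hp⟩ := hM.exists_cover
  have hP : GFD (prodRank rk deg) (freeOn k (reprSum n)) := ⟨M, genBy_reprSum hn⟩
  have hses := isSES_kernel p hp
  refine FP.of_presentation hses ⟨M, hM⟩ ?_
  choose B hB using fun y => (hl y).ker (hses.whiskerLeft (sectL D y)) (hP.layer y)
  -- Layer `L` lies above all generators of the cover and in the region where `T` vanishes; there
  -- the kernel is the whole free module. `R` bounds the generating ranks of all layers up to `L`.
  let L := max M N
  let R := ∑ j ∈ Finset.range (L + 1), B (deg.symm j)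
  have hR : ∀ y, deg y ≤ L → B y ≤ R := fun y hy => by
    have := Finset.single_le_sum (f := fun j => B (deg.symm j)) (fun _ _ => Nat.zero_le _)
      (Finset.mem_range.2 (Nat.lt_succ_of_le hy))
    simpa using this
  have hlow : ∀ x y, deg y ≤ L → ∀ w : (kernel p).obj (x, y),
      w ∈ generated (fun q => prodRank rk deg q < R + L + 1) (kernel p) (x, y) := by
    intro x y hy w
    have : generated (fun r => rk r < B y) (FinDeg.layer y (kernel p)) x ≤
        generated (fun q => prodRank rk deg q < R + L + 1) (kernel p) (x, y) :=
      generated_le fun r hr f v => by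
        refine map_mem_generated (V := kernel p) (r := (r, y)) ?_ (f ×ₘ 𝟙 y) v
        have := hR y hy
        simp only [prodRank]
        omega
    exact this (hB y x w)
  refine ⟨R + L + 1, fun q w => ?_⟩
  obtain ⟨x, y⟩ := q
  by_cases hy : deg y ≤ L
  · exact hlow x y hy w
  · have hle : generated (fun q => prodRank rk deg q < M) (freeOn k (reprSum n)) (x, y) ≤
        (generated (fun q => prodRank rk deg q < R + L + 1) (kernel p) (x, y)).map
          ((kernel.ι p).app (x, y)).hom := generated_le fun q hq f v => by
      obtain ⟨a, r⟩ := q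
      obtain ⟨f, g⟩ := f
      change (freeOn k (reprSum n)).map (f ×ₘ g) v ∈ _
      have hr : deg r < M := lt_of_le_of_lt (Nat.le_add_left _ _) hq
      obtain ⟨l, rfl⟩ : ∃ l, l = deg.symm L := ⟨_, rfl⟩
      have hl : deg (deg.symm L) = L := by simp
      -- Above layer `L`, each generator reaches `y` through layer `L`, where its image already lies
      -- in the kernel.
      obtain ⟨g1, g2, rfl⟩ := hE.exists_factor r (deg.symm L) y (by omega) (by omega) g
      have h1 : p.app (a, deg.symm L) ((freeOn k (reprSum n)).map (𝟙 a ×ₘ g1) v) = 0 :=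
        (h0 a (deg.symm L) (by omega)).elim _ _
      obtain ⟨u, hu⟩ := (hses.exact _ _).1 h1
      refine ⟨(kernel p).map (f ×ₘ g2) u, map_generated_mem _ (hlow _ _ hl.le u), ?_⟩
      refine (naturality_apply (kernel.ι p) _ u).trans ?_
      rw [hu, ← map_comp_apply]
      exact congrArg (fun φ => (freeOn k (reprSum n)).map φ v)
        (Prod.hom_ext (Category.id_comp f) rfl)
    obtain ⟨w', hw', hww⟩ := hle (genBy_reprSum hn _ ((kernel.ι p).app (x, y) w))
    rwa [← hses.inj _ hww]

end Product

/-! ### The shift in the second factor -/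

section ProductShift

open Prod

variable {k : Type u} [CommRing k] {D E : Type u} [SmallCategory D] [SmallCategory E]

/-- The shift functor in the second factor of a product. -/
def prodShift (D : Type u) [SmallCategory D] (ψ : E ⥤ E) : D × E ⥤ D × E := (𝟭 D).prod ψ

/-- The natural transformation from the identity to the shift in the second factor. -/
def prodε (D : Type u) [SmallCategory D] {ψ : E ⥤ E} (ε : 𝟭 E ⟶ ψ) :
    𝟭 (D × E) ⟶ prodShift D ψ where
  app p := (𝟙 p.1 ×ₘ ε.app p.2)
  naturality p q f := by
    have := ε.naturality f.2
    ext
    · simp [prodShift]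
    · simpa [prodShift] using this

variable {rk : D → ℕ} {deg : E ≃ ℕ} {ψ : E ⥤ E} {ε : 𝟭 E ⟶ ψ} {V W T : D × E ⥤ ModuleCat.{u} k}

/-- A module is generated in finite degrees once its derivative and its lowest layer are. -/
lemma gfd_of_deriv (hψ : ∀ y, deg (ψ.obj y) = deg y + 1)
    (hd : GFD (prodRank rk deg) (deriv (prodε D ε) V)) (h0 : GFD rk (layer (deg.symm 0) V)) :
    GFD (prodRank rk deg) V := by
  obtain ⟨M, hM⟩ := hd
  obtain ⟨N, hN⟩ := h0
  -- Lifts of generators of the derivative live at shifted objects, one rank higher; hence `M + 1`.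
  let S : D × E → Prop := fun q => prodRank rk deg q < max (M + 1) N
  have key : ∀ m x y, deg y = m → ∀ v : V.obj (x, y), v ∈ generated S V (x, y) := by
    intro m
    induction m with
    | zero =>
      intro x y hy v
      obtain rfl : y = deg.symm 0 := by rw [← hy, Equiv.symm_apply_apply]
      have : generated (fun r => rk r < N) (layer (deg.symm 0) V) x ≤
          generated S V (x, deg.symm 0) := generated_le fun r hr f v => by
        refine map_mem_generated (V := V) (r := (r, deg.symm 0)) ?_ (f ×ₘ 𝟙 _) v
        simp only [S, prodRank, Equiv.apply_symm_apply, add_zero]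
        exact lt_max_of_lt_right hr
      exact this (hN x v)
    | succ m ih =>
      intro x y hy v
      obtain ⟨z, rfl⟩ : ∃ z, z = deg.symm m := ⟨_, rfl⟩
      obtain rfl : y = ψ.obj (deg.symm m) := deg.injective (by rw [hψ, hy]; simp)
      refine mem_generated_of_deriv (ψ := prodShift D ψ) (ε := prodε D ε) (V := V) (S' := S)
        (fun q hq => ?_) (hM (x, deg.symm m)) (ih x _ (by simp)) v
      refine lt_max_of_lt_left ?_
      change rk q.1 + deg (ψ.obj q.2) < M + 1
      change rk q.1 + deg q.2 < M at hq
      rw [hψ]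
      omega
  exact ⟨_, fun q v => key _ q.1 q.2 rfl v⟩

/-- A torsion module generated in finite degrees vanishes in large degrees of the second
factor. -/
lemma exists_bound_of_torsion (hE : IsTransitiveTypeA deg) (hψ : ∀ y, deg (ψ.obj y) = deg y + 1)
    (hT : GFD (prodRank rk deg) T) (h0 : toShift (prodε D ε) T = 0) :
    ∃ N, ∀ x y, N ≤ deg y → Subsingleton (T.obj (x, y)) := by
  obtain ⟨N, hN⟩ := hT
  refine ⟨N, fun x y hy => subsingleton_of_forall_eq 0 fun v => ?_⟩
  have hle : generated (fun q => prodRank rk deg q < N) T (x, y) ≤ ⊥ :=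
    generated_le fun q hq f w => by
      obtain ⟨a, r⟩ := q
      obtain ⟨f, g⟩ := f
      have hr : deg r < N := lt_of_le_of_lt (Nat.le_add_left _ _) hq
      -- Every morphism strictly raising the degree factors through `ε`: factor it through the next
      -- degree, then correct by transitivity of the endomorphisms. It therefore kills `T`.
      obtain ⟨h, rfl⟩ : ∃ h : ψ.obj r ⟶ y, ε.app r ≫ h = g := by
        rcases (show deg r + 1 ≤ deg y by omega).lt_or_eq with hlt | heq
        · obtain ⟨g1, g2, rfl⟩ := hE.exists_factor r (ψ.obj r) y (by rw [hψ]; omega)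
            (by rw [hψ]; omega) g
          obtain ⟨σ, rfl⟩ := hE.transitive r (ψ.obj r) (by rw [hψ]; omega) (ε.app r) g1
          exact ⟨σ ≫ g2, by simp⟩
        · obtain rfl : y = ψ.obj r := deg.injective (by rw [hψ, heq])
          exact hE.transitive r (ψ.obj r) (by rw [hψ]; omega) (ε.app r) g
      have h1 : T.map ((prodε D ε).app (a, r)) w = 0 := by
        change (toShift (prodε D ε) T).app (a, r) w = 0
        rw [h0]
        rfl
      have h2 : T.map ((f, ε.app r ≫ h) : (a, r) ⟶ (x, y)) w =
          T.map (f ×ₘ h : (a, ψ.obj r) ⟶ (x, y)) (T.map ((prodε D ε).app (a, r)) w) := by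
        refine Eq.trans ?_ (map_comp_apply T ((prodε D ε).app (a, r))
          (f ×ₘ h : (a, ψ.obj r) ⟶ (x, y)) w)
        exact congrArg (fun φ => T.map φ w) (Prod.hom_ext (Category.id_comp f).symm rfl)
      rw [Submodule.mem_bot, h2, h1]
      exact map_zero (T.map (f ×ₘ h : (a, ψ.obj r) ⟶ (x, y))).hom
  exact hle (hN _ v)

end ProductShift

/-! ### Generators and relations for the derivative of a free module -/

section DerivFree

variable {k : Type u} [CommRing k] {C : Type u} [SmallCategory C] {ψ : C ⥤ C} {ε : 𝟭 C ⟶ ψ}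
variable {F : C ⥤ Type u} {V : C ⥤ ModuleCat.{u} k}

variable (k ε) in
/-- The class in the derivative of a free module of a basis element of its shift. -/
noncomputable def derivBasis {x : C} (a : F.obj (ψ.obj x)) : (deriv ε (freeOn k F)).obj x :=
  (derivπ ε (freeOn k F)).app x (basisElt k (F := F) a)

lemma map_derivBasis {x y : C} (f : x ⟶ y) (a : F.obj (ψ.obj x)) :
    (deriv ε (freeOn k F)).map f (derivBasis k ε a) = derivBasis k ε (F.map (ψ.map f) a) := by
  rw [derivBasis, ← naturality_apply]
  exact congrArg ((derivπ ε (freeOn k F)).app y) (map_basisElt (ψ.map f) a)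

lemma derivBasis_eq_zero {x : C} (a : F.obj x) :
    derivBasis k ε (F.map (ε.app x) a) = (0 : (deriv ε (freeOn k F)).obj x) := by
  rw [derivBasis, ← map_basisElt]
  exact derivπ_toShift (freeOn k F) x (basisElt k a)

lemma exists_derivDesc (φ : ∀ x, F.obj (ψ.obj x) → V.obj x)
    (hφ : ∀ {x y : C} (f : x ⟶ y) (a : F.obj (ψ.obj x)),
      φ y (F.map (ψ.map f) a) = V.map f (φ x a))
    (h0 : ∀ x (a : F.obj x), φ x (F.map (ε.app x) a) = 0) :
    ∃ η : deriv ε (freeOn k F) ⟶ V, ∀ x (a : F.obj (ψ.obj x)),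
      η.app x (derivBasis k ε a) = φ x a := by
  let η : ψ ⋙ freeOn k F ⟶ V := freeOnDesc (F := ψ ⋙ F) φ hφ
  have hη : ∀ x (a : F.obj (ψ.obj x)), η.app x (basisElt k (F := F) a) = φ x a :=
    freeOnDesc_basisElt (F := ψ ⋙ F) φ hφ
  refine ⟨cokernel.desc _ η ?_, fun x a => ?_⟩
  · apply freeOn_hom_ext
    intro x a
    refine Eq.trans ?_ (h0 x a)
    rw [← hη]
    exact congrArg (η.app x) (map_basisElt (ε.app x) a)
  · rw [← hη]
    exact congrArg (fun q : ψ ⋙ freeOn k F ⟶ V => q.app x (basisElt k (F := F) a))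
      (cokernel.π_desc (toShift ε (freeOn k F)) η _)

lemma deriv_freeOn_le {x : C} {N : Submodule k ((deriv ε (freeOn k F)).obj x)}
    (h : ∀ a : F.obj (ψ.obj x), derivBasis k ε a ∈ N) (v : (deriv ε (freeOn k F)).obj x) :
    v ∈ N := by
  obtain ⟨w, rfl⟩ := derivπ_surjective _ x v
  exact freeOn_le (N := N.comap ((derivπ ε (freeOn k F)).app x).hom) h w

lemma deriv_freeOn_hom_ext {f g : deriv ε (freeOn k F) ⟶ V}
    (h : ∀ x (a : F.obj (ψ.obj x)), f.app x (derivBasis k ε a) = g.app x (derivBasis k ε a)) :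
    f = g := by
  ext x v
  exact deriv_freeOn_le (N := LinearMap.eqLocus (f.app x).hom (g.app x).hom) (h x) v

lemma freeOn_map_injective {x y : C} {f : x ⟶ y} (h : Function.Injective (F.map f)) :
    Function.Injective ((freeOn k F).map f) :=
  Finsupp.mapDomain_injective h

lemma basisElt_injective [Nontrivial k] (x : C) :
    Function.Injective (basisElt k : F.obj x → (freeOn k F).obj x) :=
  Finsupp.single_left_injective one_ne_zero

end DerivFree

/-! ### Derivatives of free modules over a product -/

section ProductFree

open Prod

variable {k : Type u} [CommRing k] {D E : Type u} [SmallCategory D] [SmallCategory E]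
variable {rk : D → ℕ} {deg : E ≃ ℕ} {ψ : E ⥤ E} {ε : 𝟭 E ⟶ ψ}

/-- Over a nonzero `k`, injectivity on the modules `M(r)` of `E` says that composition with `ε` is
injective on morphisms, which passes to the product and linearizes back. -/
lemma torsionFree_reprSum (hψ : IsShift k deg ψ ε) {I : Type u} (n : I → D × E) :
    TorsionFree (prodε D ε) (freeOn k (reprSum n)) := by
  intro p
  rcases subsingleton_or_nontrivial k with hk | hk
  · have := Module.subsingleton k ((freeOn k (reprSum n)).obj p)
    exact Function.injective_of_subsingleton _
  · refine freeOn_map_injective (F := reprSum n) (f := (prodε D ε).app p) fun a b hab => ?_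
    obtain ⟨i, f⟩ := a
    obtain ⟨j, g⟩ := b
    obtain ⟨rfl, h2⟩ := Sigma.mk.inj hab
    have h3 : f ≫ (prodε D ε).app p = g ≫ (prodε D ε).app p := eq_of_heq h2
    have h4 : f.1 ≫ 𝟙 _ = g.1 ≫ 𝟙 _ := congrArg Prod.fst h3
    have h5 : f.2 ≫ ε.app p.2 = g.2 ≫ ε.app p.2 := congrArg Prod.snd h3
    have h6 : f.2 = g.2 := by
      apply basisElt_injective (k := k) (F := coyoneda.obj (Opposite.op (n i).2)) p.2
      apply hψ.injective (n i).2 p.2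
      refine (map_basisElt (F := coyoneda.obj (Opposite.op (n i).2)) (ε.app p.2) f.2).trans
        (Eq.trans ?_ (map_basisElt (F := coyoneda.obj (Opposite.op (n i).2)) (ε.app p.2) g.2).symm)
      exact congrArg (basisElt k (F := coyoneda.obj (Opposite.op (n i).2))) h5
    have h7 : f.1 = g.1 := by simpa using h4
    rw [show f = g from Prod.hom_ext h7 h6]

/-- The class of a morphism in the derivative of `M(r)`. -/
noncomputable def freeDerivBasis (k : Type u) [CommRing k] {ψ : E ⥤ E} (ε : 𝟭 E ⟶ ψ) {r y : E}
    (g : r ⟶ ψ.obj y) : (deriv ε (freeModule k r)).obj y :=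
  derivBasis k ε (F := coyoneda.obj (Opposite.op r)) g

lemma map_freeDerivBasis {r y z : E} (g : r ⟶ ψ.obj y) (h : y ⟶ z) :
    (deriv ε (freeModule k r)).map h (freeDerivBasis k ε g) = freeDerivBasis k ε (g ≫ ψ.map h) :=
  map_derivBasis (F := coyoneda.obj (Opposite.op r)) h g

lemma freeDerivBasis_eq_zero {r y : E} (g : r ⟶ y) :
    freeDerivBasis k ε (g ≫ ε.app y) = (0 : (deriv ε (freeModule k r)).obj y) :=
  derivBasis_eq_zero (F := coyoneda.obj (Opposite.op r)) g

lemma exists_freeDerivDesc {r : E} {V : E ⥤ ModuleCat.{u} k} (φ : ∀ y, (r ⟶ ψ.obj y) → V.obj y)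
    (hφ : ∀ {x y : E} (f : x ⟶ y) (a : r ⟶ ψ.obj x), φ y (a ≫ ψ.map f) = V.map f (φ x a))
    (h0 : ∀ x (a : r ⟶ x), φ x (a ≫ ε.app x) = 0) :
    ∃ η : deriv ε (freeModule k r) ⟶ V, ∀ y (g : r ⟶ ψ.obj y),
      η.app y (freeDerivBasis k ε g) = φ y g :=
  exists_derivDesc (F := coyoneda.obj (Opposite.op r)) φ hφ h0

variable {I : Type u} (n : I → D × E)

/-- The class of a pair of morphisms in the derivative of a direct sum of modules `M(n i)`. -/
noncomputable def reprDerivBasis (k : Type u) [CommRing k] {ψ : E ⥤ E} (ε : 𝟭 E ⟶ ψ) (i : I)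
    {x : D} {y : E} (f : (n i).1 ⟶ x) (g : (n i).2 ⟶ ψ.obj y) :
    (deriv (prodε D ε) (freeOn k (reprSum n))).obj (x, y) :=
  derivBasis k (prodε D ε) (F := reprSum n) (x := (x, y))
    (reprMk n (x := (x, ψ.obj y)) i (f, g))

variable {n}

lemma map_reprDerivBasis (i : I) {x x' : D} {y y' : E} (f : (n i).1 ⟶ x) (g : (n i).2 ⟶ ψ.obj y)
    (a : x ⟶ x') (b : y ⟶ y') :
    (deriv (prodε D ε) (freeOn k (reprSum n))).map (a ×ₘ b) (reprDerivBasis n k ε i f g) =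
      reprDerivBasis n k ε i (f ≫ a) (g ≫ ψ.map b) :=
  map_derivBasis (F := reprSum n) (ψ := prodShift D ψ) (a ×ₘ b) _

lemma reprDerivBasis_eq_zero (i : I) {x : D} {y : E} (f : (n i).1 ⟶ x) (g : (n i).2 ⟶ y) :
    reprDerivBasis n k ε i f (g ≫ ε.app y) = 0 := by
  refine Eq.trans ?_ (derivBasis_eq_zero (k := k) (ε := prodε D ε) (F := reprSum n)
    (reprMk n (x := (x, y)) i (f, g)))
  have : ((f, g ≫ ε.app y) : n i ⟶ (x, ψ.obj y)) =
      ((f, g) : n i ⟶ (x, y)) ≫ (prodε D ε).app (x, y) :=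
    Prod.hom_ext (Category.comp_id f).symm rfl
  exact congrArg (fun h => derivBasis k (prodε D ε) (F := reprSum n) (x := (x, y))
    (reprMk n (x := (x, ψ.obj y)) i h)) this

lemma deriv_reprSum_le {x : D} {y : E}
    {N : Submodule k ((deriv (prodε D ε) (freeOn k (reprSum n))).obj (x, y))}
    (h : ∀ i (f : (n i).1 ⟶ x) (g : (n i).2 ⟶ ψ.obj y), reprDerivBasis n k ε i f g ∈ N)
    (v : (deriv (prodε D ε) (freeOn k (reprSum n))).obj (x, y)) : v ∈ N :=
  deriv_freeOn_le (F := reprSum n) (fun a => h a.1 a.2.1 a.2.2) v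

lemma deriv_reprSum_hom_ext {X : D × E ⥤ ModuleCat.{u} k}
    {p q : deriv (prodε D ε) (freeOn k (reprSum n)) ⟶ X}
    (h : ∀ x y i (f : (n i).1 ⟶ x) (g : (n i).2 ⟶ ψ.obj y),
      p.app (x, y) (reprDerivBasis n k ε i f g) = q.app (x, y) (reprDerivBasis n k ε i f g)) :
    p = q :=
  deriv_freeOn_hom_ext (F := reprSum n) fun z a => h z.1 z.2 a.1 a.2.1 a.2.2

lemma exists_reprDerivDesc {X : D × E ⥤ ModuleCat.{u} k}
    (φ : ∀ x y i, ((n i).1 ⟶ x) → ((n i).2 ⟶ ψ.obj y) → X.obj (x, y))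
    (hφ : ∀ {x x' : D} {y y' : E} (a : x ⟶ x') (b : y ⟶ y') i (f : (n i).1 ⟶ x)
      (g : (n i).2 ⟶ ψ.obj y), φ x' y' i (f ≫ a) (g ≫ ψ.map b) = X.map (a ×ₘ b) (φ x y i f g))
    (h0 : ∀ x y i (f : (n i).1 ⟶ x) (g : (n i).2 ⟶ y), φ x y i f (g ≫ ε.app y) = 0) :
    ∃ η : deriv (prodε D ε) (freeOn k (reprSum n)) ⟶ X,
      ∀ x y i (f : (n i).1 ⟶ x) (g : (n i).2 ⟶ ψ.obj y),
        η.app (x, y) (reprDerivBasis n k ε i f g) = φ x y i f g := by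
  obtain ⟨η, hη⟩ := exists_derivDesc (k := k) (ε := prodε D ε) (F := reprSum n) (V := X)
    (fun p a => φ p.1 p.2 a.1 a.2.1 a.2.2) (fun f a => hφ f.1 f.2 a.1 a.2.1 a.2.2)
    (fun p a => (congrArg (fun f => φ p.1 p.2 a.1 f (a.2.2 ≫ ε.app p.2))
      (Category.comp_id a.2.1)).trans (h0 p.1 p.2 a.1 a.2.1 a.2.2))
  exact ⟨η, fun x y i f g => hη (x, y) (reprMk n (x := (x, ψ.obj y)) i (f, g))⟩

/-- The derivative of `M(r)` maps to the derivative of each summand of a direct sum. -/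
lemma exists_deriv_map (i : I) :
    ∃ η : deriv ε (freeModule k (n i).2) ⟶
      sectR (n i).1 E ⋙ deriv (prodε D ε) (freeOn k (reprSum n)),
      ∀ y (g : (n i).2 ⟶ ψ.obj y),
        η.app y (freeDerivBasis k ε g) = reprDerivBasis n k ε i (𝟙 _) g := by
  refine exists_freeDerivDesc
    (V := sectR (n i).1 E ⋙ deriv (prodε D ε) (freeOn k (reprSum n)))
    (fun y g => reprDerivBasis n k ε i (𝟙 _) g) (fun {x y} f a => ?_)
    (fun x a => reprDerivBasis_eq_zero i (𝟙 _) a)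
  refine Eq.trans ?_ (map_reprDerivBasis i (𝟙 (n i).1) a (𝟙 _) f).symm
  rw [Category.comp_id]

/-- The derivative of `M(a, r)` is generated from the slice over `a`, onto which the derivative of
`M(r)` maps; the latter is generated in degrees below that of `r`. -/
lemma genBy_deriv_reprSum (hψ : IsShift k deg ψ ε) {S T : D × E → Prop} (hn : ∀ i, S (n i))
    (hS : ∀ a r s, S (a, r) → deg s < deg r → T (a, s)) :
    GenBy T (deriv (prodε D ε) (freeOn k (reprSum n))) := by
  rintro ⟨x, y⟩
  apply deriv_reprSum_le
  intro i f g
  obtain ⟨η, hη⟩ := exists_deriv_map (k := k) (n := n) (ε := ε) i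
  have h1 : (deriv (prodε D ε) (freeOn k (reprSum n))).map (f ×ₘ 𝟙 y)
      (η.app y (freeDerivBasis k ε g)) = reprDerivBasis n k ε i f g := by
    rw [hη]
    refine (map_reprDerivBasis i (𝟙 _) g f (𝟙 y)).trans ?_
    rw [Category.id_comp, ψ.map_id, Category.comp_id]
  rw [← h1]
  apply map_generated_mem (V := deriv (prodε D ε) (freeOn k (reprSum n)))
  have h2 := app_mem_generated η
    (genBy_of_generationDegree (hψ.generationDegree_cokernel (n i).2) y (freeDerivBasis k ε g))
  refine (generated_le fun s hs h v => ?_ :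
    generated (fun s => deg s < deg (n i).2) _ y ≤ generated T _ ((n i).1, y)) h2
  exact map_mem_generated (V := deriv (prodε D ε) (freeOn k (reprSum n))) (hS _ _ _ (hn i) hs)
    (𝟙 _ ×ₘ h) v

/-- The derivative of `M(a, r)` is the external product of `M(a)` with the derivative of `M(r)`. A
lifting problem out of it thus reduces to one over `E` on the slice at `a`, solved by projectivity
in the shift axiom. -/
lemma projective_deriv_reprSum (hψ : IsShift k deg ψ ε) :
    Projective (deriv (prodε D ε) (freeOn k (reprSum n))) where
  factors {X Y} h e he := by
    choose η hη using fun i => exists_deriv_map (k := k) (n := n) (ε := ε) i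
    have hu : ∀ i, ∃ u : deriv ε (freeModule k (n i).2) ⟶ sectR (n i).1 E ⋙ X,
        u ≫ Functor.whiskerLeft (sectR (n i).1 E) e =
          η i ≫ Functor.whiskerLeft (sectR (n i).1 E) h := fun i => by
      have h1 : Projective (deriv ε (freeModule k (n i).2)) := hψ.projective_cokernel _
      have h2 : Epi (Functor.whiskerLeft (sectR (n i).1 E) e) :=
        epi_of_surjective fun y => surjective_of_epi e _
      exact ⟨_, Projective.factorThru_comp _ _⟩
    choose u hu using hu
    obtain ⟨U, hU, hU0, hUe⟩ : ∃ U : ∀ i y, ((n i).2 ⟶ ψ.obj y) → X.obj ((n i).1, y),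
        (∀ i {y z} (b : y ⟶ z) g, U i z (g ≫ ψ.map b) = X.map (𝟙 (n i).1 ×ₘ b) (U i y g)) ∧
        (∀ i y g, U i y (g ≫ ε.app y) = 0) ∧
        ∀ i y g, e.app ((n i).1, y) (U i y g) =
          h.app ((n i).1, y) (reprDerivBasis n k ε i (𝟙 _) g) := by
      refine ⟨fun i y g => (u i).app y (freeDerivBasis k ε g), fun i y z b g => ?_,
        fun i y g => ?_, fun i y g => ?_⟩
      · exact (congrArg ((u i).app z) (map_freeDerivBasis g b).symm).trans
          (naturality_apply (u i) b _)
      · exact (congrArg ((u i).app y) (freeDerivBasis_eq_zero g)).trans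
          (map_zero ((u i).app y).hom)
      · rw [← hη]
        exact congrArg (fun q : _ ⟶ sectR (n i).1 E ⋙ Y => q.app y (freeDerivBasis k ε g)) (hu i)
    -- Spread the slice solutions along the `D` direction by functoriality of `X`.
    obtain ⟨l, hl⟩ := exists_reprDerivDesc (k := k) (n := n) (ε := ε) (X := X)
      (fun x y i f g => X.map (f ×ₘ 𝟙 y) (U i y g))
      (fun {x x' y y'} a b i f g => by
        rw [hU, ← map_comp_apply, ← map_comp_apply]
        congr 2
        ext
        simp)
      (fun x y i f g => by rw [hU0, map_zero])
    refine ⟨l, deriv_reprSum_hom_ext fun x y i f g => ?_⟩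
    rw [comp_app_apply, hl, naturality_apply, hUe, ← naturality_apply]
    congr 1
    refine (map_reprDerivBasis i (𝟙 _) g f (𝟙 y)).trans ?_
    rw [Category.id_comp, ψ.map_id, Category.comp_id]

end ProductFree

/-! ### The inductive step for coherence -/

section ProductCoherence

open Prod

variable {k : Type u} [CommRing k] {D E : Type u} [SmallCategory D] [SmallCategory E]
variable {rk : D → ℕ} {deg : E ≃ ℕ} {ψ : E ⥤ E} {ε : 𝟭 E ⟶ ψ}
variable {V W X : D × E ⥤ ModuleCat.{u} k}

lemma GenBy.deriv (hψ : IsShift k deg ψ ε) {S T : D × E → Prop} (hV : GenBy S V)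
    (hS : ∀ a r s, S (a, r) → deg s < deg r → T (a, s)) :
    GenBy T (deriv (prodε D ε) V) := by
  obtain ⟨I, n, p, hn, hp⟩ := hV.exists_cover
  exact (genBy_deriv_reprSum hψ hn hS).of_surjective (derivMap _ p) (derivMap_surjective hp)

lemma GFD.deriv (hψ : IsShift k deg ψ ε) (hV : GFD (prodRank rk deg) V) :
    GFD (prodRank rk deg) (deriv (prodε D ε) V) := by
  obtain ⟨N, hN⟩ := hV
  refine ⟨N, hN.deriv hψ fun a r s h hs => ?_⟩
  simp only [prodRank] at h ⊢
  omega

lemma kernel_lift_surjective {C : Type u} [SmallCategory C] {A B K : C ⥤ ModuleCat.{u} k}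
    (f : K ⟶ A) (g : A ⟶ B) (h : ∀ n, Function.Exact (f.app n) (g.app n)) (n : C) :
    Function.Surjective ((kernel.lift g f (comp_eq_zero_of_exact h)).app n) := fun z => by
  obtain ⟨y, hy⟩ := (h n _).1 ((exact_kernel_app g n).apply_apply_eq_zero z)
  refine ⟨y, injective_of_mono (kernel.ι g) n ?_⟩
  rw [← comp_app_apply, kernel.lift_ι, hy]

/-- Right exactness presents the derivative of `V` by a projective, with kernel a quotient of the
derivative of the original kernel. -/
lemma FP.deriv (hψ : IsShift k deg ψ ε) (hV : FP (prodRank rk deg) V) :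
    FP (prodRank rk deg) (deriv (prodε D ε) V) := by
  obtain ⟨I, n, p, hP, hp⟩ := hV.gfd.exists_cover
  have hses := isSES_kernel p hp
  have := projective_deriv_reprSum (n := n) hψ
  exact FP.of_presentation (isSES_kernel (derivMap (prodε D ε) p) (derivMap_surjective hp))
    (hV.gfd.deriv hψ) (((hV.ker hses hP).deriv hψ).of_surjective _
      (kernel_lift_surjective _ _ (derivMap_exact hses)))

/-- A homomorphism exact at the middle term factors as an epimorphism onto the kernel of the next
one. -/
lemma isSES_kernel_lift {C : Type u} [SmallCategory C] {A B K : C ⥤ ModuleCat.{u} k}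
    (f : K ⟶ A) (g : A ⟶ B) (h : ∀ n, Function.Exact (f.app n) (g.app n)) :
    IsSES (kernel.ι f) (kernel.lift g f (comp_eq_zero_of_exact h)) where
  inj := injective_of_mono _
  exact n y := by
    rw [← exact_kernel_app f n y]
    have h1 : (kernel.ι g).app n ((kernel.lift g f (comp_eq_zero_of_exact h)).app n y) =
        f.app n y := by rw [← comp_app_apply, kernel.lift_ι]
    rw [← h1]
    exact (map_eq_zero_iff ((kernel.ι g).app n).hom (injective_of_mono (kernel.ι g) n)).symm
  surj := kernel_lift_surjective f g h

lemma fp_kernel_of_genBy (hE : IsTransitiveTypeA deg) (hψ : IsShift k deg ψ ε)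
    (hD : Coherent k rk) (d : ℕ) : ∀ {W X V : D × E ⥤ ModuleCat.{u} k} {i : W ⟶ X} {p : X ⟶ V},
      IsSES i p → FP (prodRank rk deg) X → FP (prodRank rk deg) V →
      GenBy (fun q => deg q.2 < d) V → FP (prodRank rk deg) W := by
  induction d with
  | zero =>
    intro W X V i p h hX hV hd
    -- No generators are allowed, so `V` is zero and `i` is bijective.
    refine hX.of_bijective i fun q => ⟨h.inj q, fun x => (h.exact q x).1 ?_⟩
    have : generated (fun q : D × E => deg q.2 < 0) V q ≤ ⊥ :=
      generated_le fun r hr => absurd hr (Nat.not_lt_zero _)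
    exact this (hd q _)
  | succ d ih =>
    intro W X V i p h hX hV hd
    obtain ⟨I, n, c, hP, hc⟩ := hX.gfd.exists_cover
    have hs : ∀ q, Function.Surjective ((c ≫ p).app q) := fun q => (h.surj q).comp (hc q)
    have hW' := isSES_kernel (c ≫ p) hs
    obtain ⟨a, b, hab, -, -⟩ := exists_isSES_of_comp (isSES_kernel c hc) h hW'
    -- `W` is the quotient of `kernel (c ≫ p)` by `kernel c`, so the free module may replace `X`.
    refine FP.quotient hab (hX.ker (isSES_kernel c hc) hP) ?_
    have hPfp : FP (prodRank rk deg) (freeOn k (reprSum n)) := hP.fp_of_projective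
    have hKgfd := hV.ker hW' hP
    have hPt : TorsionFree (prodε D ε) (freeOn k (reprSum n)) := torsionFree_reprSum hψ n
    have hKt : TorsionFree (prodε D ε) (kernel (c ≫ p)) := hPt.of_injective _ hW'.inj
    obtain ⟨J, m, e, hQ, he⟩ := hKgfd.exists_cover
    have hR := isSES_kernel e he
    refine FP.of_presentation hR hKgfd (gfd_of_deriv (ε := ε) hψ.deg_obj ?_ ?_)
    · have hDK := hKgfd.deriv hψ
      suffices FP (prodRank rk deg) (FinDeg.deriv (prodε D ε) (kernel (c ≫ p))) from
        this.ker (derivMap_isSES hR hKt) (hQ.deriv hψ)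
      have hex := derivMap_exact (ε := prodε D ε) hW'
      -- The inner induction applies because differentiation lowers the bound on the `E`-degrees of
      -- generators from `d + 1` to `d`.
      have hZ := ih (isSES_kernel (derivMap (prodε D ε) (c ≫ p)) (derivMap_surjective hs))
        (hPfp.deriv hψ) (hV.deriv hψ) (hd.deriv hψ fun _ r s h hs => by
          simp only at h ⊢
          omega)
      have hT := isSES_kernel_lift _ _ hex
      refine FP.extension hT ?_ hZ
      have hTgfd := hZ.ker hT hDK
      obtain ⟨θ, hθ, hθ0⟩ := exists_kernel_derivMap hW' hPt
      have hT0 : toShift (prodε D ε)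
          (kernel (derivMap (prodε D ε) (kernel.ι (c ≫ p)))) = 0 := by
        have : Mono (Functor.whiskerLeft (prodShift D ψ) θ) := mono_of_injective fun q => hθ _
        rw [← cancel_mono (Functor.whiskerLeft (prodShift D ψ) θ), toShift_naturality, hθ0,
          zero_comp]
      obtain ⟨N, hN⟩ := exists_bound_of_torsion hE hψ.deg_obj hTgfd hT0
      -- Each layer of the torsion kernel embeds in a layer of `V`, which is FP over `D`; coherence
      -- of `D` makes it FP.
      exact fp_of_layers hE hTgfd (fun y => hD.fp_of_injective (layerMap y θ) (fun x => hθ _)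
        (hTgfd.layer y) (hV.layer y)) hN
    · exact (hD.fp_of_injective (layerMap (deg.symm 0) (kernel.ι (c ≫ p))) (fun x => hW'.inj _)
        (hKgfd.layer _) (hPfp.layer _)).ker (hR.whiskerLeft (sectL D (deg.symm 0))) (hQ.layer _)

/-- Coherence passes to the product with a category admitting a shift. -/
theorem Coherent.prod (hE : IsTransitiveTypeA deg) (hψ : IsShift k deg ψ ε)
    (hD : Coherent k rk) : Coherent k (prodRank rk deg) := fun W X V i p h hX hV => by
  obtain ⟨N, hN⟩ := hV.gfd
  exact fp_kernel_of_genBy hE hψ hD N h hX hV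
    (hN.mono fun q hq => lt_of_le_of_lt (Nat.le_add_left _ _) hq)

end ProductCoherence

/-! ### Transport along a fully faithful functor surjective on objects -/

section Transport

variable {k : Type u} [CommRing k] {A B : Type u} [SmallCategory A] [SmallCategory B]
variable {G : A ⥤ B} {rkA : A → ℕ} {rkB : B → ℕ} {V : B ⥤ ModuleCat.{u} k}

lemma gfd_comp_iff [G.Full] (hG : Function.Surjective G.obj) (hrk : ∀ a, rkB (G.obj a) = rkA a) :
    GFD rkA (G ⋙ V) ↔ GFD rkB V := by
  refine exists_congr fun N => ⟨fun h b v => ?_, fun h a v => ?_⟩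
  · obtain ⟨a, rfl⟩ := hG b
    have : generated (fun r => rkA r < N) (G ⋙ V) a ≤
        generated (fun r => rkB r < N) V (G.obj a) := generated_le fun r hr f w =>
      map_mem_generated (V := V) (r := G.obj r) (by rwa [hrk]) (G.map f) w
    exact this (h a v)
  · have : generated (fun r => rkB r < N) V (G.obj a) ≤
        generated (fun r => rkA r < N) (G ⋙ V) a := generated_le fun b hb f w => by
      obtain ⟨r, rfl⟩ := hG b
      obtain ⟨g, rfl⟩ := G.map_surjective f
      exact map_mem_generated (V := G ⋙ V) (by rwa [← hrk]) g w
    exact this (h (G.obj a) v)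

lemma projective_comp [G.Full] [G.Faithful] (hG : Function.Surjective G.obj) {I : Type u}
    (n : I → B) : Projective (G ⋙ freeOn k (reprSum n)) := by
  choose m hm using fun i => hG (n i)
  obtain rfl : n = fun i => G.obj (m i) := funext fun i => (hm i).symm
  refine projective_of_basis (F := G ⋙ reprSum fun i => G.obj (m i)) m
    (fun i => reprMk (fun i => G.obj (m i)) i (𝟙 _)) fun x => ?_
  have key : ∀ p : Σ i, (m i ⟶ x), (G ⋙ reprSum fun i => G.obj (m i)).map p.2
      (reprMk (fun i => G.obj (m i)) p.1 (𝟙 _)) =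
        (⟨p.1, G.map p.2⟩ : Σ i, (G.obj (m i) ⟶ G.obj x)) := fun p =>
    congrArg (Sigma.mk p.1) (Category.id_comp (G.map p.2))
  constructor
  · intro p q hpq
    have h := (key p).symm.trans (hpq.trans (key q))
    obtain ⟨i, f⟩ := p
    obtain ⟨j, g⟩ := q
    obtain ⟨rfl, h2⟩ := Sigma.mk.inj h
    obtain rfl := G.map_injective (eq_of_heq h2)
    rfl
  · rintro ⟨i, f⟩
    obtain ⟨g, rfl⟩ := G.map_surjective f
    exact ⟨⟨i, g⟩, key ⟨i, g⟩⟩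

lemma fp_comp_iff [G.Full] [G.Faithful] (hG : Function.Surjective G.obj)
    (hrk : ∀ a, rkB (G.obj a) = rkA a) : FP rkA (G ⋙ V) ↔ FP rkB V := by
  constructor
  · intro h
    exact ⟨(gfd_comp_iff hG hrk).1 h.gfd, fun h' hX =>
      (gfd_comp_iff hG hrk).1 (h.ker (h'.whiskerLeft G) ((gfd_comp_iff hG hrk).2 hX))⟩
  · intro h
    obtain ⟨I, n, p, hP, hp⟩ := h.gfd.exists_cover
    have := projective_comp (k := k) hG n
    exact FP.of_presentation ((isSES_kernel p hp).whiskerLeft G) ((gfd_comp_iff hG hrk).2 h.gfd)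
      ((gfd_comp_iff hG hrk).2 (h.ker (isSES_kernel p hp) hP))

lemma Coherent.of_functor (G : A ⥤ B) [G.Full] [G.Faithful] (hG : Function.Surjective G.obj)
    (hrk : ∀ a, rkB (G.obj a) = rkA a) (h : Coherent k rkA) : Coherent k rkB :=
  fun _ _ _ _ _ hs hX hV => (fp_comp_iff hG hrk).1
    (h _ _ (hs.whiskerLeft G) ((fp_comp_iff hG hrk).2 hX) ((fp_comp_iff hG hrk).2 hV))

end Transport

/-! ### Induction on the number of factors -/

section Pi

variable {k : Type u} [CommRing k]

/-- Adjoining a first component to an object of a product of categories. -/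
def piCons {m : ℕ} (C : Fin (m + 1) → Type u) [∀ i, SmallCategory (C i)] :
    (∀ i : Fin m, C i.succ) × C 0 ⥤ ∀ i, C i where
  obj p := Fin.cons p.2 p.1
  map {p q} f := Fin.cons (α := fun i => (Fin.cons p.2 p.1 : ∀ i, C i) i ⟶
    (Fin.cons q.2 q.1 : ∀ i, C i) i) f.2 f.1
  map_id p := by
    funext i
    refine Fin.cases ?_ (fun j => ?_) i <;> rfl
  map_comp f g := by
    funext i
    refine Fin.cases ?_ (fun j => ?_) i <;> rfl

theorem coherent_pi (m : ℕ) (C : Fin m → Type u) [∀ i, SmallCategory (C i)]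
    (deg : ∀ i, C i ≃ ℕ) (hC : ∀ i, IsTransitiveTypeA (deg i)) (ψ : ∀ i, C i ⥤ C i)
    (ε : ∀ i, 𝟭 (C i) ⟶ ψ i) (hψ : ∀ i, IsShift k (deg i) (ψ i) (ε i)) :
    Coherent k (totalRank deg) := by
  induction m with
  | zero =>
    have key : ∀ V : (∀ i, C i) ⥤ ModuleCat.{u} k, GFD (totalRank deg) V := fun V =>
      -- Every object of the empty product has rank zero, so the bound `1` admits all elements as
      -- generators.
      ⟨1, fun n v => by
        have := map_mem_generated (V := V) (S := fun r => totalRank deg r < 1) (r := n)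
          (by simp [totalRank]) (𝟙 n) v
        rwa [V.map_id] at this⟩
    exact fun W _ _ _ _ _ _ _ => ⟨key W, fun _ _ => key _⟩
  | succ m ih =>
    have h1 := (ih (fun i => C i.succ) (fun i => deg i.succ) (fun i => hC _) (fun i => ψ _)
      (fun i => ε _) (fun i => hψ _)).prod (hC 0) (hψ 0)
    have : (piCons C).Full := ⟨fun {p q} f => ⟨(fun i => f i.succ, f 0), by
      funext i
      refine Fin.cases ?_ (fun j => ?_) i <;> rfl⟩⟩
    have : (piCons C).Faithful := ⟨fun {p q} f g h => Prod.hom_ext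
      (funext fun i => congrFun h i.succ) (congrFun h 0)⟩
    refine Coherent.of_functor (piCons C) (fun n => ⟨(fun i => n i.succ, n 0), ?_⟩)
      (fun p => ?_) h1
    · exact Fin.cons_self_tail n
    · simp only [totalRank, prodRank, Fin.sum_univ_succ, piCons, Fin.cons_zero, Fin.cons_succ]
      exact Nat.add_comm _ _

end Pi

/-! ### Kernels, cokernels and images -/

section Abelian

variable {k : Type u} [CommRing k] {C : Type u} [SmallCategory C] {rk : C → ℕ}

/-- The image is a quotient of `U`, so generated in finite degrees, and a submodule of `V`, so FP by
coherence. The kernel follows by coherence, the cokernel by `FP.quotient`. -/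
lemma Coherent.fp_kernel_cokernel_image (h : Coherent k rk) {U V : C ⥤ ModuleCat.{u} k}
    (α : U ⟶ V) (hU : FP rk U) (hV : FP rk V) :
    FP rk (kernel α) ∧ FP rk (cokernel α) ∧ FP rk (image α) := by
  have hgfd : GFD rk (image α) := hU.gfd.of_surjective (factorThruImage α) (surjective_of_epi _)
  have hI : FP rk (image α) := h.fp_of_injective (image.ι α) (injective_of_mono _) hgfd hV
  have hk : IsSES (kernel.ι α) (factorThruImage α) := by
    refine ⟨injective_of_mono _, fun n x => ?_, surjective_of_epi _⟩
    rw [← exact_kernel_app α n x]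
    have h1 : (image.ι α).app n ((factorThruImage α).app n x) = α.app n x := by
      rw [← comp_app_apply, image.fac]
    rw [← h1]
    exact (map_eq_zero_iff ((image.ι α).app n).hom (injective_of_mono (image.ι α) n)).symm
  have hc : IsSES (image.ι α) (cokernel.π α) := by
    refine ⟨injective_of_mono _, fun n x => ?_, surjective_of_epi _⟩
    rw [exact_cokernel_app α n x]
    have h1 : ∀ y, (image.ι α).app n ((factorThruImage α).app n y) = α.app n y := fun y => by
      rw [← comp_app_apply, image.fac]
    constructor
    · rintro ⟨y, rfl⟩
      exact ⟨_, h1 y⟩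
    · rintro ⟨z, rfl⟩
      obtain ⟨y, rfl⟩ := surjective_of_epi (factorThruImage α) n z
      exact ⟨y, (h1 y).symm⟩
  exact ⟨h _ _ hk hU hI, hV.quotient hc hgfd, hI⟩

end Abelian

/-! ### The abelian structure on the full subcategory -/

section AbelianSubcategory

/-- A binary product is a biproduct, hence a split extension of its factors. -/
lemma isClosedUnderFiniteProducts_of_extensions {A : Type*} [Category* A] [Abelian A]
    (P : ObjectProperty A) [P.ContainsZero] [P.IsClosedUnderIsomorphisms]
    [P.IsClosedUnderExtensions] : P.IsClosedUnderFiniteProducts := by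
  have : P.IsClosedUnderBinaryProducts := ⟨by
    rintro X ⟨p⟩
    have e : X ≅ p.diag.obj ⟨.left⟩ ⊞ p.diag.obj ⟨.right⟩ :=
      IsLimit.conePointUniqueUpToIso p.isLimit (limit.isLimit _) ≪≫
        HasLimit.isoOfNatIso (diagramIsoPair p.diag) ≪≫ (biprod.isoProd _ _).symm
    exact P.prop_of_iso e.symm (P.prop_biprod (p.prop_diag_obj _) (p.prop_diag_obj _))⟩
  exact ObjectProperty.IsClosedUnderFiniteProducts.mk'

variable {k : Type u} [CommRing k] {C : Type u} [SmallCategory C] {rk : C → ℕ}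

lemma presentedInFiniteDegrees_eq (rk : C → ℕ) :
    PresentedInFiniteDegrees (k := k) rk = FP rk :=
  funext fun _ => propext presentedInFiniteDegrees_iff

lemma Coherent.exists_abelian (h : Coherent k rk) :
    ∃ A : Abelian (PresentedInFiniteDegrees (k := k) rk).FullSubcategory,
      A.toPreadditive =
        (inferInstance : Preadditive (PresentedInFiniteDegrees (k := k) rk).FullSubcategory) := by
  rw [presentedInFiniteDegrees_eq]
  let P : ObjectProperty (C ⥤ ModuleCat.{u} k) := FP rk
  have : P.IsClosedUnderIsomorphisms := ⟨fun e h => h.of_iso e⟩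
  have : P.ContainsZero := ⟨_, isZero_zero (C ⥤ ModuleCat.{u} k),
    (gfd_of_subsingleton fun n => ModuleCat.subsingleton_of_isZero
      ((Functor.isZero_iff _).1 (isZero_zero _) n)).fp_of_projective⟩
  have : P.IsClosedUnderExtensions := ⟨fun {S} hS h₁ h₃ => by
    have := hS.mono_f
    have := hS.epi_g
    exact FP.extension ⟨injective_of_mono S.f, (exact_iff_app S).1 hS.exact,
      surjective_of_epi S.g⟩ h₁ h₃⟩
  have : P.IsClosedUnderKernels := ⟨by
    rintro _ ⟨f, c, hc, hf⟩
    exact P.prop_of_iso (IsLimit.conePointUniqueUpToIso (kernelIsKernel f) hc)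
      (h.fp_kernel_cokernel_image f hf.1 hf.2).1⟩
  have : P.IsClosedUnderCokernels := ⟨by
    rintro _ ⟨f, c, hc, hf⟩
    exact P.prop_of_iso (IsColimit.coconePointUniqueUpToIso (cokernelIsCokernel f) hc)
      (h.fp_kernel_cokernel_image f hf.1 hf.2).2.1⟩
  have : P.IsClosedUnderFiniteProducts := isClosedUnderFiniteProducts_of_extensions P
  exact ⟨(inferInstance : Abelian P.FullSubcategory), rfl⟩

end AbelianSubcategory

end FinDeg

theorem mainTheorem2 (k : Type u) [CommRing k] (m : ℕ)
    (C : Fin m → Type u) [∀ i, SmallCategory (C i)] (deg : ∀ i, C i ≃ ℕ)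
    (hC : ∀ i, FinDeg.IsTransitiveTypeA (deg i))
    (ψ : ∀ i, C i ⥤ C i) (ε : ∀ i, 𝟭 (C i) ⟶ ψ i)
    (hψ : ∀ i, FinDeg.IsShift k (deg i) (ψ i) (ε i)) :
    let P : ObjectProperty ((∀ i, C i) ⥤ ModuleCat.{u} k) :=
      FinDeg.PresentedInFiniteDegrees (FinDeg.totalRank deg)
    (∃ A : Abelian P.FullSubcategory,
      A.toPreadditive = (inferInstance : Preadditive P.FullSubcategory)) ∧
    ∀ (U V : (∀ i, C i) ⥤ ModuleCat.{u} k) (α : U ⟶ V), P U → P V →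
      P (kernel α) ∧ P (cokernel α) ∧ P (image α) := by
  intro P
  have h := FinDeg.coherent_pi m C deg hC ψ ε hψ
  refine ⟨h.exists_abelian, fun U V α hU hV => ?_⟩
  have := h.fp_kernel_cokernel_image α (FinDeg.presentedInFiniteDegrees_iff.1 hU)
    (FinDeg.presentedInFiniteDegrees_iff.1 hV)
  exact ⟨FinDeg.presentedInFiniteDegrees_iff.2 this.1,
    FinDeg.presentedInFiniteDegrees_iff.2 this.2.1,
    FinDeg.presentedInFiniteDegrees_iff.2 this.2.2⟩
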